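/- Let $n\ge 0$ and let $P=([-n,n],\preceq_P)$ be a $B_n$ poset, i.e. a partial order on $[-n,n]=\{-n,\dots,n\}$ with $i\preceq_P j\iff -j\preceq_P -i$ for all $i,j\in[-n,n]$. Notation. Let $\mathfrak S^B_n$ be the group of permutations $\gamma$ of $[-n,n]$ with $\gamma(-i)=-\gamma(i)$; for $1\le i\le n-1$ let $s_i\in\mathfrak S^B_n$ exchange $i$ and $i+1$ (and $-i$ and $-i-1$), and let $s_0$ exchange $1$ and $-1$. For $0\le i\le n-1$, $s_i$ is a descent of $\gamma$ if $\gamma(i)>\gamma(i+1)$. A type-$B$ linear extension of $P$ is a total order on $[-n,n]$ that extends $\preceq_P$ and is itself a $B_n$ poset. Let $\Sigma^B_R(P)$ be the set of all $\gamma\in\mathfrak S^B_n$ such that the total order $\gamma(-n)\prec\cdots\prec\gamma(0)\prec\cdots\prec\gamma(n)$ is a type-$B$ linear extension of $P$. Let $H^B_n(0)$ be the $\mathbb C$-algebra generated by $\bar\pi_0,\dots,\bar\pi_{n-1}$ with relations $\bar\pi_i^2=-\bar\pi_i$; $\bar\pi_i\bar\pi_{i+1}\bar\pi_i=\bar\pi_{i+1}\bar\pi_i\bar\pi_{i+1}$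 for $1\le i<n-1$; $\bar\pi_i\bar\pi_j=\bar\pi_j\bar\pi_i$ for $|i-j|\ge2$; $\bar\pi_0\bar\pi_1\bar\pi_0\bar\pi_1=\bar\pi_1\bar\pi_0\bar\pi_1\bar\pi_0$ (if $n\ge2$). For $I\subseteq\{0,\dots,n-1\}$ let $\mathbf F^B_I=\mathbb C v_I$ be the one-dimensional right $H^B_n(0)$-module with $v_I\bar\pi_i=-v_I$ if $i\in I$ and $v_I\bar\pi_i=0$ otherwise. The classes $[\mathbf F^B_I]$ form a $\mathbb Z$-basis of the Grothendieck group of finite-dimensional right $H^B_n(0)$-modules (with $[M]=[M']+[M'']$ for every short exact sequence $0\to M'\to M\to M''\to0$). Let $\mathrm{ch}^B$ be the $\mathbb Z$-linear map from this group to $\mathbb Z[[x_0,x_1,\dots]]$ with $\mathrm{ch}^B([\mathbf F^B_I])=F^B_I$, where $$F^B_I=\sum_{\substack{0=a_0\le a_1\le\cdots\le a_n\\ a_j<a_{j+1}\text{ if }j\in I}}x_{a_1}\cdots x_{a_n}$$ is the type-$B$ fundamental quasisymmetric function (its values are type-$B$ quasisymmetric functions). Theorem. The vector space $M^B_P=\mathbb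 C\,\Sigma^B_R(P)$ with basis $\Sigma^B_R(P)$ is a right $H^B_n(0)$-module with the action given, for $\gamma\in\Sigma^B_R(P)$ and $0\le i\le n-1$, by $$\gamma\cdot\bar\pi_i=\begin{cases}-\gamma&\text{if }s_i\text{ is a descent of }\gamma,\\ 0&\text{if }s_i\text{ is not a descent of }\gamma\text{ and }\gamma s_i\notin\Sigma^B_R(P),\\ \gamma s_i&\text{if }s_i\text{ is not a descent of }\gamma\text{ and }\gamma s_i\in\Sigma^B_R(P),\end{cases}$$ and $$\mathrm{ch}^B([M^B_P])=K^B_P:=\sum_f x_{|f(1)|}x_{|f(2)|}\cdots x_{|f(n)|},$$ where $f$ runs over the type-$B$ $P$-partitions, i.e. the maps $f:[-n,n]\to\mathbb Z$ such that $f(-i)=-f(i)$ for all $i$, $f(i)\le f(j)$ whenever $i\preceq_P j$, and $f(i)<f(j)$ whenever $i\preceq_P j$ and $i>j$ as integers. -/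

import Mathlib

set_option linter.unusedSimpArgs false

noncomputable section

namespace TypeB

/-! ### Signed permutations -/

/-- The set `[-n, n]` of integers. -/
abbrev SInt (n : ℕ) : Type := Set.Icc (-(n : ℤ)) (n : ℤ)

instance (n : ℕ) : Neg (SInt n) :=
  ⟨fun i => ⟨-i.1, by have := i.2.1; have := i.2.2; constructor <;> omega⟩⟩

@[simp] theorem SInt.coe_neg {n : ℕ} (i : SInt n) : ((-i : SInt n) : ℤ) = -(i : ℤ) := rfl

theorem SInt.neg_neg {n : ℕ} (i : SInt n) : - -i = i := Subtype.ext (by simp)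

/-- The element `j` of `[-n, n]`, for `0 ≤ j ≤ n`. -/
def SInt.pos {n : ℕ} (j : Fin (n + 1)) : SInt n :=
  ⟨(j : ℕ), by have := j.2; constructor <;> omega⟩

@[simp] theorem SInt.coe_pos {n : ℕ} (j : Fin (n + 1)) :
    ((SInt.pos j : SInt n) : ℤ) = ((j : ℕ) : ℤ) := rfl

/-- The hyperoctahedral group: permutations `σ` of `[-n, n]` with `σ (-i) = -σ i`
(so that `σ 0 = 0`). -/
def SignedPerm (n : ℕ) : Subgroup (Equiv.Perm (SInt n)) where
  carrier := {σ | ∀ i, σ (-i) = -σ i}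
  mul_mem' := by
    intro a b ha hb i
    simp only [Set.mem_ofPred_eq] at ha hb
    simp [Equiv.Perm.mul_apply, ha, hb]
  one_mem' := by intro i; rfl
  inv_mem' := by
    intro a ha i
    simp only [Set.mem_ofPred_eq] at ha
    rw [Equiv.Perm.inv_eq_iff_eq, ha]; simp

/-- The simple reflections: for `1 ≤ i < n` the signed permutation `s i` exchanges `i` and `i + 1`
(and `-i` and `-(i + 1)`), and `s 0` exchanges `1` and `-1`. -/
def sPerm {n : ℕ} (i : Fin n) : Equiv.Perm (SInt n) :=
  if (i : ℕ) = 0 then Equiv.swap (SInt.pos i.succ) (-SInt.pos i.succ)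
  else Equiv.swap (SInt.pos i.castSucc) (SInt.pos i.succ) *
    Equiv.swap (-SInt.pos i.castSucc) (-SInt.pos i.succ)

/-- `s i` in coordinates. -/
theorem coe_sPerm {n : ℕ} (i : Fin n) (x : SInt n) :
    ((sPerm i x : SInt n) : ℤ) =
      (if (i : ℕ) = 0 then
        (if (x : ℤ) = 1 then -1 else if (x : ℤ) = -1 then 1 else (x : ℤ) : ℤ)
      else if (x : ℤ) = i then (i : ℤ) + 1 else if (x : ℤ) = i + 1 then (i : ℤ)
      else if (x : ℤ) = -i then -(i : ℤ) - 1 else if (x : ℤ) = -i - 1 then -(i : ℤ)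
      else (x : ℤ) : ℤ) := by
  unfold sPerm
  by_cases h : (i : ℕ) = 0
  · simp only [h, if_true, Equiv.swap_apply_def, Subtype.ext_iff, SInt.coe_neg, SInt.coe_pos,
      Fin.val_succ]
    split_ifs <;> simp_all
  · simp only [h, if_false, Equiv.Perm.mul_apply, Equiv.swap_apply_def, Subtype.ext_iff,
      SInt.coe_neg, SInt.coe_pos, Fin.val_succ, Fin.val_castSucc, apply_ite Subtype.val]
    push_cast
    split_ifs <;> omega

/-- `s i` as an element of the hyperoctahedral group. -/
def s {n : ℕ} (i : Fin n) : SignedPerm n :=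
  ⟨sPerm i, by
    intro x
    apply Subtype.ext
    rw [SInt.coe_neg, coe_sPerm, coe_sPerm, SInt.coe_neg]
    split_ifs <;> omega⟩

/-- The right descent set of `γ`: `s i` is a right descent of `γ` iff `γ i > γ (i + 1)`. -/
def IsDescent {n : ℕ} (γ : SignedPerm n) (i : Fin n) : Prop :=
  γ.1 (SInt.pos i.castSucc) > γ.1 (SInt.pos i.succ)

/-! ### `B_n` posets, linear extensions and `P`-partitions -/

/-- A `B_n` poset: a partial order on `[-n, n]` with `i ≼ j ↔ -j ≼ -i`. -/
@[ext] structure BPoset (n : ℕ) where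
  le : SInt n → SInt n → Prop
  refl : ∀ i, le i i
  trans : ∀ i j k, le i j → le j k → le i k
  antisymm : ∀ i j, le i j → le j i → i = j
  neg_iff : ∀ i j, le i j ↔ le (-j) (-i)

/-- Type-`B` linear extensions of `P`: total orders containing `P` that are `B_n` posets. -/
def linExt {n : ℕ} (P : BPoset n) : Set (BPoset n) :=
  {E | (∀ i j, P.le i j → E.le i j) ∧ ∀ i j, E.le i j ∨ E.le j i}

/-- The totally ordered `B_n` poset `P(γ)`: `i ≼ j` iff `γ⁻¹ i ≤ γ⁻¹ j`. -/
def posetOfPerm {n : ℕ} (γ : SignedPerm n) : BPoset n where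
  le i j := (γ⁻¹).1 i ≤ (γ⁻¹).1 j
  refl _ := le_refl _
  trans _ _ _ := le_trans
  antisymm i j h₁ h₂ := (γ⁻¹).1.injective (le_antisymm h₁ h₂)
  neg_iff i j := by
    rw [(γ⁻¹).2 i, (γ⁻¹).2 j, ← Subtype.coe_le_coe, ← Subtype.coe_le_coe, SInt.coe_neg,
      SInt.coe_neg, neg_le_neg_iff]

/-- The set `Σ^B_R(P)` of the signed permutations `γ_E`, where `E` is a type-`B` linear extension
of `P` and `γ_E` is the signed permutation with `P(γ_E) = E`. -/
def sigmaB {n : ℕ} (P : BPoset n) : Set (SignedPerm n) :=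
  {γ | ∃ E ∈ linExt P, posetOfPerm γ = E}

/-- Type-`B` `P`-partitions. -/
def partitionsB {n : ℕ} (P : BPoset n) : Set (SInt n → ℤ) :=
  {f | (∀ i j, P.le i j → f i ≤ f j) ∧ (∀ i j, P.le i j → i > j → f i < f j) ∧
    ∀ i, f (-i) = -f i}

/-! ### Generating functions in `ℤ⟦x₀, x₁, x₂, …⟧` -/

/-- The generating function `∑_{a ∈ A} x_{w(a,1)} x_{w(a,2)} ⋯ x_{w(a,n)}`: the coefficient of a
monomial is the number of `a ∈ A` that contribute this monomial. -/
def genFun {α : Type} {n : ℕ} (A : Set α) (w : α → Fin n → ℕ) : MvPowerSeries ℕ ℤ :=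
  fun m => (({a | a ∈ A ∧ ∑ j, Finsupp.single (w a j) 1 = m} : Set α).ncard : ℤ)

/-- The type-`B` `P`-partition enumerator `K^B_P = ∑_f x_{|f(1)|} ⋯ x_{|f(n)|}`. -/
def KB {n : ℕ} (P : BPoset n) : MvPowerSeries ℕ ℤ :=
  genFun (partitionsB P) (fun f (j : Fin n) => (f (SInt.pos j.succ)).natAbs)

/-- The sequences `0 = a₀ ≤ a₁ ≤ ⋯ ≤ aₙ` with `a_j < a_{j+1}` for `j ∈ I`. -/
def fundSeqs {n : ℕ} (I : Finset (Fin n)) : Set (Fin (n + 1) → ℕ) :=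
  {a | a 0 = 0 ∧ (∀ j : Fin n, a j.castSucc ≤ a j.succ) ∧
    ∀ j ∈ I, a (Fin.castSucc j) < a j.succ}

/-- The type-`B` fundamental quasisymmetric function `F^B_I = ∑ x_{a₁} ⋯ x_{aₙ}`, for
`I ⊆ [0, n - 1]`. -/
def FB {n : ℕ} (I : Finset (Fin n)) : MvPowerSeries ℕ ℤ :=
  genFun (fundSeqs I) (fun a (j : Fin n) => a j.succ)

theorem finite_of_weight {n : ℕ} (m : ℕ →₀ ℕ) :
    {w : Fin n → ℕ | ∑ j, Finsupp.single (w j) 1 = m}.Finite := by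
  refine (Set.Finite.pi' (fun _ : Fin n => m.support.finite_toSet)).subset ?_
  intro w hw j
  simp only [Set.mem_ofPred_eq] at hw
  simp only [Finset.mem_coe, Finsupp.mem_support_iff, ← hw, Finsupp.finsetSum_apply]
  intro h
  have := (Finset.sum_eq_zero_iff.1 h) j (Finset.mem_univ _)
  simp at this

/-- Only finitely many sequences contribute to a given coefficient of `F^B_I`. -/
theorem FB_finite {n : ℕ} (I : Finset (Fin n)) (m : ℕ →₀ ℕ) :
    {a | a ∈ fundSeqs I ∧ ∑ j : Fin n, Finsupp.single (a j.succ) 1 = m}.Finite := by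
  refine Set.Finite.of_finite_image (f := fun a (j : Fin n) => a j.succ)
    ((finite_of_weight (n := n) m).subset ?_) ?_
  · rintro _ ⟨a, ha, rfl⟩; exact ha.2
  · intro a ha b hb h
    funext j
    refine Fin.cases ?_ (fun j => congrFun h j) j
    rw [ha.1.1, hb.1.1]

/-- Only finitely many `P`-partitions contribute to a given coefficient of `K^B_P`. -/
theorem KB_finite {n : ℕ} (P : BPoset n) (m : ℕ →₀ ℕ) :
    {f | f ∈ partitionsB P ∧
      ∑ j : Fin n, Finsupp.single (f (SInt.pos j.succ)).natAbs 1 = m}.Finite := by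
  have hfin : {f : SInt n → ℤ | ∀ x, f x ∈ Set.Icc (-((m.support.sup id : ℕ) : ℤ))
      ((m.support.sup id : ℕ) : ℤ)}.Finite := Set.Finite.pi' (fun _ => Set.finite_Icc _ _)
  refine hfin.subset ?_
  rintro f ⟨⟨-, -, hneg⟩, hf⟩ x
  have key : ∀ j : Fin n, (f (SInt.pos j.succ)).natAbs ≤ m.support.sup id := by
    intro j
    refine Finset.le_sup (f := id) ?_
    simp only [Finsupp.mem_support_iff, ← hf, Finsupp.finsetSum_apply]
    intro h
    have := (Finset.sum_eq_zero_iff.1 h) j (Finset.mem_univ _)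
    erw [Finsupp.single_eq_same] at this
    exact one_ne_zero this
  have hx1 := x.2.1
  have hx2 := x.2.2
  have hx : (f x).natAbs ≤ m.support.sup id := by
    rcases lt_trichotomy (x : ℤ) 0 with h | h | h
    · have e : x = -SInt.pos (Fin.succ ⟨(x : ℤ).natAbs - 1, by omega⟩) := by
        apply Subtype.ext; simp; omega
      rw [e, hneg, Int.natAbs_neg]; exact key _
    · have e : -x = x := by apply Subtype.ext; simp [h]
      have := hneg x
      rw [e] at this
      have : f x = 0 := by omega
      simp [this]
    · have e : x = SInt.pos (Fin.succ ⟨(x : ℤ).natAbs - 1, by omega⟩) := by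
        apply Subtype.ext; simp; omega
      rw [e]; exact key _
  constructor <;> omega

/-! ### The `0`-Hecke algebra of type `B_n` -/

/-- The defining relations of the `0`-Hecke algebra of type `B_n`. -/
inductive HeckeRel (n : ℕ) : FreeAlgebra ℂ (Fin n) → FreeAlgebra ℂ (Fin n) → Prop
  | quad (i : Fin n) : HeckeRel n (.ι ℂ i * .ι ℂ i) (-.ι ℂ i)
  | braid3 (i j : Fin n) (hi : 1 ≤ (i : ℕ)) (hj : (j : ℕ) = i + 1) :
      HeckeRel n (.ι ℂ i * .ι ℂ j * .ι ℂ i) (.ι ℂ j * .ι ℂ i * .ι ℂ j)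
  | comm (i j : Fin n) (hij : (i : ℕ) + 2 ≤ j) :
      HeckeRel n (.ι ℂ i * .ι ℂ j) (.ι ℂ j * .ι ℂ i)
  | braid4 (i j : Fin n) (hi : (i : ℕ) = 0) (hj : (j : ℕ) = 1) :
      HeckeRel n (.ι ℂ i * .ι ℂ j * .ι ℂ i * .ι ℂ j) (.ι ℂ j * .ι ℂ i * .ι ℂ j * .ι ℂ i)

/-- The `0`-Hecke algebra `H_n^B(0)` over `ℂ`. -/
abbrev HeckeB (n : ℕ) : Type := RingQuot (HeckeRel n)

/-- The generator `π̄_i` of `H_n^B(0)`. -/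
def opi {n : ℕ} (i : Fin n) : HeckeB n := RingQuot.mkAlgHom ℂ (HeckeRel n) (.ι ℂ i)

/-- Operators `T_0, …, T_{n-1}`, written on the left, satisfying the relations of the
`0`-Hecke algebra. -/
structure HeckeOps {n : ℕ} {V : Type} [AddCommGroup V] [Module ℂ V]
    (T : Fin n → Module.End ℂ V) : Prop where
  quad : ∀ i v, T i (T i v) = -T i v
  braid3 : ∀ i j : Fin n, 1 ≤ (i : ℕ) → (j : ℕ) = i + 1 →
    ∀ v, T i (T j (T i v)) = T j (T i (T j v))
  comm : ∀ i j : Fin n, (i : ℕ) + 2 ≤ j → ∀ v, T i (T j v) = T j (T i v)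
  braid4 : ∀ i j : Fin n, (i : ℕ) = 0 → (j : ℕ) = 1 →
    ∀ v, T j (T i (T j (T i v))) = T i (T j (T i (T j v)))

/-- The right action of `H_n^B(0)` in which `π̄_i` acts by `T i`. -/
def heckeRep {n : ℕ} {V : Type} [AddCommGroup V] [Module ℂ V]
    {T : Fin n → Module.End ℂ V} (hT : HeckeOps T) : HeckeB n →ₐ[ℂ] (Module.End ℂ V)ᵐᵒᵖ :=
  RingQuot.liftAlgHom ℂ ⟨FreeAlgebra.lift ℂ fun i => MulOpposite.op (T i), by
    intro x y h
    cases h with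
    | quad i =>
      simp only [map_mul, map_neg, FreeAlgebra.lift_ι_apply, ← MulOpposite.op_mul,
        ← MulOpposite.op_neg]
      congr 1; ext v; simpa using hT.quad i v
    | braid3 i j hi hj =>
      simp only [map_mul, FreeAlgebra.lift_ι_apply, ← MulOpposite.op_mul]
      congr 1; ext v; simpa using hT.braid3 i j hi hj v
    | comm i j hij =>
      simp only [map_mul, FreeAlgebra.lift_ι_apply, ← MulOpposite.op_mul]
      congr 1; ext v; simpa using (hT.comm i j hij v).symm
    | braid4 i j hi hj =>
      simp only [map_mul, FreeAlgebra.lift_ι_apply, ← MulOpposite.op_mul]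
      congr 1; ext v; simpa using hT.braid4 i j hi hj v⟩

@[simp] theorem heckeRep_opi {n : ℕ} {V : Type} [AddCommGroup V] [Module ℂ V]
    {T : Fin n → Module.End ℂ V} (hT : HeckeOps T) (i : Fin n) :
    heckeRep hT (opi i) = MulOpposite.op (T i) := by
  unfold heckeRep opi
  rw [RingQuot.liftAlgHom_mkAlgHom_apply]
  simp

/-! ### Finite-dimensional right modules and their Grothendieck group -/

/-- A finite-dimensional right module over a `ℂ`-algebra `A`. -/
structure FDMod (A : Type) [Ring A] [Algebra ℂ A] where
  carrier : Type
  [addCommGroup : AddCommGroup carrier]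
  [moduleC : Module ℂ carrier]
  [moduleA : Module Aᵐᵒᵖ carrier]
  [scalarTower : IsScalarTower ℂ Aᵐᵒᵖ carrier]
  [finiteDimensional : FiniteDimensional ℂ carrier]

attribute [instance] FDMod.addCommGroup FDMod.moduleC FDMod.moduleA FDMod.scalarTower
  FDMod.finiteDimensional

instance (A : Type) [Ring A] [Algebra ℂ A] : CoeSort (FDMod A) Type := ⟨FDMod.carrier⟩

/-- `0 → M' → M → M'' → 0` is exact for some homomorphisms of right `A`-modules. -/
def IsShortExact {A : Type} [Ring A] [Algebra ℂ A] (M' M M'' : FDMod A) : Prop :=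
  ∃ (f : M' →ₗ[Aᵐᵒᵖ] M) (g : M →ₗ[Aᵐᵒᵖ] M''),
    Function.Injective f ∧ Function.Exact f g ∧ Function.Surjective g

/-- The relations `[M] - [M'] - [M'']` of the Grothendieck group. -/
def k0Rels (A : Type) [Ring A] [Algebra ℂ A] : AddSubgroup (FreeAbelianGroup (FDMod A)) :=
  AddSubgroup.closure {x | ∃ M' M M'' : FDMod A, IsShortExact M' M M'' ∧
    x = FreeAbelianGroup.of M - FreeAbelianGroup.of M' - FreeAbelianGroup.of M''}

/-- The Grothendieck group `G_0` of the category of finite-dimensional right `A`-modules. -/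
abbrev G0 (A : Type) [Ring A] [Algebra ℂ A] : Type 1 :=
  FreeAbelianGroup (FDMod A) ⧸ k0Rels A

/-- The class `[M]`. -/
def G0.mk {A : Type} [Ring A] [Algebra ℂ A] (M : FDMod A) : G0 A :=
  QuotientAddGroup.mk (FreeAbelianGroup.of M)

/-- The right `H_n^B(0)`-module `V` on which `π̄_i` acts by `T i`. -/
def heckeModule {n : ℕ} (V : Type) [AddCommGroup V] [Module ℂ V] [FiniteDimensional ℂ V]
    {T : Fin n → Module.End ℂ V} (hT : HeckeOps T) : FDMod (HeckeB n) :=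
  letI : Module (HeckeB n)ᵐᵒᵖ V :=
    { smul := fun a v => (heckeRep hT a.unop).unop v
      one_smul := fun v => by change (heckeRep hT 1).unop v = v; simp
      mul_smul := fun a b v => by
        change (heckeRep hT (b.unop * a.unop)).unop v =
          (heckeRep hT a.unop).unop ((heckeRep hT b.unop).unop v)
        simp
      smul_zero := fun a => by change (heckeRep hT a.unop).unop 0 = 0; simp
      smul_add := fun a v w => by
        change (heckeRep hT a.unop).unop (v + w) =
          (heckeRep hT a.unop).unop v + (heckeRep hT a.unop).unop w
        simp
      add_smul := fun a b v => by
        change (heckeRep hT (a.unop + b.unop)).unop v =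
          (heckeRep hT a.unop).unop v + (heckeRep hT b.unop).unop v
        simp
      zero_smul := fun v => by change (heckeRep hT 0).unop v = 0; simp }
  { carrier := V
    scalarTower := ⟨fun c a v => by
      change (heckeRep hT (c • a.unop)).unop v = c • (heckeRep hT a.unop).unop v
      simp⟩ }

/-- `π̄_i` acts on `heckeModule V hT` by `T i`. -/
theorem heckeModule_opi {n : ℕ} (V : Type) [AddCommGroup V] [Module ℂ V] [FiniteDimensional ℂ V]
    {T : Fin n → Module.End ℂ V} (hT : HeckeOps T) (i : Fin n) (v : V) :
    MulOpposite.op (opi i) • (show heckeModule V hT from v) = T i v := by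
  change (heckeRep hT (opi i)).unop v = T i v
  rw [heckeRep_opi]; rfl

/-! ### The poset module -/

theorem mem_sigmaB {n : ℕ} {P : BPoset n} {γ : SignedPerm n} :
    γ ∈ sigmaB P ↔ ∀ a b, P.le (γ.1 a) (γ.1 b) → a ≤ b := by
  have key : ∀ i, (γ⁻¹).1 (γ.1 i) = i := fun i => by simp
  have key' : ∀ i, γ.1 ((γ⁻¹).1 i) = i := fun i => by simp
  constructor
  · rintro ⟨E, hE, rfl⟩ a b h
    have := hE.1 _ _ h
    change (γ⁻¹).1 _ ≤ (γ⁻¹).1 _ at this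
    rwa [key, key] at this
  · intro h
    refine ⟨_, ⟨fun i j hij => ?_, fun i j => ?_⟩, rfl⟩
    · change (γ⁻¹).1 i ≤ (γ⁻¹).1 j
      apply h
      rwa [key', key']
    · exact le_total _ _

/-- The operator on `ℂ Σ^B_R(P)` by which `π̄_i` acts: `γ` is sent to `-γ` if `s i` is a right
descent of `γ`, and otherwise to `γ s_i` if this lies in `Σ^B_R(P)` and to `0` if not. -/
def posetOp {n : ℕ} (P : BPoset n) (i : Fin n) : Module.End ℂ (sigmaB P →₀ ℂ) :=
  open Classical in
  Finsupp.linearCombination ℂ fun γ : sigmaB P =>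
    if IsDescent γ.1 i then -Finsupp.single γ 1
    else if h : γ.1 * s i ∈ sigmaB P then Finsupp.single ⟨γ.1 * s i, h⟩ 1 else 0

/-- The lower partner of `i + 1` in the reflection `s i`. -/
def lo {n : ℕ} (i : Fin n) : SInt n :=
  if (i : ℕ) = 0 then -SInt.pos i.succ else SInt.pos i.castSucc

/-- An auxiliary operator on `ℂ 𝔖^B_n` that extends `posetOp`. -/
def bigOp {n : ℕ} (P : BPoset n) (i : Fin n) : Module.End ℂ (SignedPerm n →₀ ℂ) :=
  open Classical in
  Finsupp.linearCombination ℂ fun γ : SignedPerm n =>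
    if γ.1 (lo i) > γ.1 (SInt.pos i.succ) then -Finsupp.single γ 1
    else if P.le (γ.1 (lo i)) (γ.1 (SInt.pos i.succ)) then 0 else Finsupp.single (γ * s i) 1

theorem isDescent_iff {n : ℕ} (γ : SignedPerm n) (i : Fin n) :
    IsDescent γ i ↔ γ.1 (lo i) > γ.1 (SInt.pos i.succ) := by
  unfold IsDescent lo
  split_ifs with h
  · have h0 : γ.1 (SInt.pos i.castSucc) = -γ.1 (SInt.pos i.castSucc) := by
      rw [← γ.2]; congr 1; apply Subtype.ext; simp [h]
    have h1 := γ.2 (SInt.pos i.succ)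
    rw [Subtype.ext_iff] at h0 h1
    simp only [SInt.coe_neg] at h0 h1
    rw [gt_iff_lt, gt_iff_lt, ← Subtype.coe_lt_coe, ← Subtype.coe_lt_coe, h1]
    omega
  · rfl

theorem mul_s_apply {n : ℕ} (γ : SignedPerm n) (i : Fin n) (x : SInt n) :
    (γ * s i).1 x = γ.1 (sPerm i x) := rfl

theorem le_neg_apply {n : ℕ} (P : BPoset n) (γ : SignedPerm n) (x y : SInt n) :
    P.le (γ.1 (-x)) (γ.1 (-y)) ↔ P.le (γ.1 y) (γ.1 x) := by
  rw [γ.2, γ.2, ← P.neg_iff]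

theorem sPerm_hi {n : ℕ} (i : Fin n) : sPerm i (SInt.pos i.succ) = lo i := by
  apply Subtype.ext
  rw [coe_sPerm]; unfold lo
  split_ifs <;> simp_all

theorem sPerm_lo {n : ℕ} (i : Fin n) : sPerm i (lo i) = SInt.pos i.succ := by
  apply Subtype.ext
  rw [coe_sPerm]; unfold lo
  split_ifs <;> simp_all

theorem lo_lt {n : ℕ} (i : Fin n) : lo i < SInt.pos i.succ := by
  rw [← Subtype.coe_lt_coe]; unfold lo
  split_ifs <;> simp <;> omega

theorem mul_s_mem {n : ℕ} {P : BPoset n} {γ : SignedPerm n} (hγ : γ ∈ sigmaB P) (i : Fin n) :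
    γ * s i ∈ sigmaB P ↔ ¬ P.le (γ.1 (lo i)) (γ.1 (SInt.pos i.succ)) := by
  rw [mem_sigmaB] at hγ ⊢
  constructor
  · intro h hle
    have := h (SInt.pos i.succ) (lo i) (by rwa [mul_s_apply, mul_s_apply, sPerm_hi, sPerm_lo])
    exact absurd (lo_lt i) (not_lt.2 this)
  · intro hle a b hab
    rw [mul_s_apply, mul_s_apply] at hab
    by_contra hlt
    have h1 := hγ _ _ hab
    apply hle
    rw [not_le, ← Subtype.coe_lt_coe] at hlt
    rw [← Subtype.coe_le_coe, coe_sPerm, coe_sPerm] at h1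
    have hx := coe_sPerm i a
    have hy := coe_sPerm i b
    have hl : ((lo i : SInt n) : ℤ) = if (i : ℕ) = 0 then -1 else (i : ℤ) := by
      unfold lo; split_ifs <;> simp_all
    have hh : ((SInt.pos i.succ : SInt n) : ℤ) = (i : ℤ) + 1 := by simp
    set x := sPerm i a
    set y := sPerm i b
    by_cases h0 : (i : ℕ) = 0
    · simp only [h0, if_true] at h1 hx hy hl
      rcases (by omega : ((x : ℤ) = -1 ∧ (y : ℤ) = 1) ∨ ((x : ℤ) = 0 ∧ (y : ℤ) = 1) ∨
          ((x : ℤ) = -1 ∧ (y : ℤ) = 0)) with ⟨hx', hy'⟩ | ⟨hx', hy'⟩ | ⟨hx', hy'⟩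
      · rwa [show lo i = x from Subtype.ext (by omega),
          show SInt.pos i.succ = y from Subtype.ext (by omega)]
      · refine P.trans _ (γ.1 x) _ ?_ ?_
        · rw [← le_neg_apply, show -x = x from Subtype.ext (by simp [hx']),
            show -lo i = y from Subtype.ext (by rw [SInt.coe_neg]; omega)]
          exact hab
        · rwa [show SInt.pos i.succ = y from Subtype.ext (by omega)]
      · refine P.trans _ (γ.1 y) _ ?_ ?_
        · rwa [show lo i = x from Subtype.ext (by omega)]
        · rw [← le_neg_apply, show -y = y from Subtype.ext (by simp [hy']),
            show -SInt.pos i.succ = x from Subtype.ext (by rw [SInt.coe_neg]; omega)]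
          exact hab
    · simp only [h0, if_false] at h1 hx hy hl
      have hcase : ((x : ℤ) = i ∧ (y : ℤ) = i + 1) ∨ ((x : ℤ) = -i - 1 ∧ (y : ℤ) = -i) := by
        split_ifs at hx hy h1 <;> omega
      rcases hcase with ⟨hx', hy'⟩ | ⟨hx', hy'⟩
      · rwa [show lo i = x from Subtype.ext (by omega),
          show SInt.pos i.succ = y from Subtype.ext (by omega)]
      · rw [← le_neg_apply, show -lo i = y from Subtype.ext (by rw [SInt.coe_neg]; omega),
          show -SInt.pos i.succ = x from Subtype.ext (by rw [SInt.coe_neg]; omega)]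
        exact hab

theorem mapDomain_posetOp {n : ℕ} (P : BPoset n) (i : Fin n) (v : sigmaB P →₀ ℂ) :
    Finsupp.mapDomain Subtype.val (posetOp P i v) =
      bigOp P i (Finsupp.mapDomain Subtype.val v) := by
  classical
  induction v using Finsupp.induction_linear with
  | zero => simp
  | add v w hv hw => simp [Finsupp.mapDomain_add, hv, hw]
  | single γ c =>
    rw [Finsupp.mapDomain_single, posetOp, bigOp, Finsupp.linearCombination_single,
      Finsupp.linearCombination_single, Finsupp.mapDomain_smul]
    congr 1
    by_cases h : IsDescent γ.1 i
    · rw [if_pos h, if_pos ((isDescent_iff _ _).1 h)]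
      rw [← Finsupp.single_neg, ← Finsupp.single_neg, Finsupp.mapDomain_single]
    · rw [if_neg h, if_neg (fun h' => h ((isDescent_iff _ _).2 h'))]
      by_cases h' : P.le (γ.1.1 (lo i)) (γ.1.1 (SInt.pos i.succ))
      · rw [if_pos h', dif_neg (fun hm => (mul_s_mem γ.2 i).1 hm h'), Finsupp.mapDomain_zero]
      · rw [if_neg h', dif_pos ((mul_s_mem γ.2 i).2 h'), Finsupp.mapDomain_single]

theorem bigOp_single {n : ℕ} (P : BPoset n) (i : Fin n) (γ : SignedPerm n) :
    bigOp P i (Finsupp.single γ 1) = open Classical in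
      if γ.1 (lo i) > γ.1 (SInt.pos i.succ) then -Finsupp.single γ 1
      else if P.le (γ.1 (lo i)) (γ.1 (SInt.pos i.succ)) then 0
      else Finsupp.single (γ * s i) 1 := by
  rw [bigOp, Finsupp.linearCombination_single, one_smul]

theorem end_ext {n : ℕ} {f g : Module.End ℂ (SignedPerm n →₀ ℂ)}
    (h : ∀ γ, f (Finsupp.single γ 1) = g (Finsupp.single γ 1)) (v) : f v = g v := by
  have : f = g := by
    apply Finsupp.lhom_ext
    intro γ c
    rw [← mul_one c, ← smul_eq_mul, ← Finsupp.smul_single, map_smul, map_smul, h]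
  rw [this]

theorem lt_cases {n : ℕ} (P : BPoset n) (γ : SignedPerm n) {x y : SInt n} (h : (x : ℤ) ≠ y) :
    (γ.1 x < γ.1 y ∧ ¬ γ.1 y < γ.1 x ∧ (P.le (γ.1 x) (γ.1 y) ∨ ¬ P.le (γ.1 x) (γ.1 y))) ∨
    (γ.1 y < γ.1 x ∧ ¬ γ.1 x < γ.1 y ∧ (P.le (γ.1 y) (γ.1 x) ∨ ¬ P.le (γ.1 y) (γ.1 x))) :=
  (lt_or_gt_of_ne fun e => h (congrArg _ (γ.1.injective e))).imp
    (fun h => ⟨h, not_lt.2 h.le, em _⟩) (fun h => ⟨h, not_lt.2 h.le, em _⟩)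

theorem sPerm_fix {n : ℕ} (i : Fin n) (x : SInt n)
    (h : (x : ℤ) ≠ i + 1 ∧ (x : ℤ) ≠ -i - 1 ∧
      ((i : ℕ) = 0 ∨ ((x : ℤ) ≠ i ∧ (x : ℤ) ≠ -i))) : sPerm i x = x := by
  apply Subtype.ext
  rw [coe_sPerm]; split_ifs <;> omega

theorem sPerm_neg {n : ℕ} (i : Fin n) (x : SInt n) : sPerm i (-x) = -sPerm i x := (s i).2 x

theorem coe_lo {n : ℕ} (i : Fin n) :
    (((i : ℕ) = 0 ∧ ((lo i : SInt n) : ℤ) = -1) ∨ ((i : ℕ) ≠ 0 ∧ ((lo i : SInt n) : ℤ) = i)) := by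
  unfold lo; split_ifs with h <;> simp [h]

theorem coe_hi {n : ℕ} (i : Fin n) : ((SInt.pos i.succ : SInt n) : ℤ) = (i : ℤ) + 1 := by simp

theorem s_comm {n : ℕ} (i j : Fin n) (hij : (i : ℕ) + 2 ≤ j) (γ : SignedPerm n) :
    γ * s i * s j = γ * s j * s i := by
  simp only [mul_assoc]; congr 1
  apply Subtype.ext; refine Equiv.ext fun x => ?_
  change sPerm i (sPerm j x) = sPerm j (sPerm i x)
  have c1 := coe_lo i
  have c2 := coe_hi i
  have c3 := coe_lo j
  have c4 := coe_hi j
  have e1 : sPerm i (SInt.pos j.succ) = SInt.pos j.succ := sPerm_fix _ _ (by omega)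
  have e2 : sPerm i (lo j) = lo j := sPerm_fix _ _ (by omega)
  by_cases h1 : x = SInt.pos j.succ
  · rw [h1, e1, sPerm_hi, e2]
  by_cases h2 : x = lo j
  · rw [h2, e2, sPerm_lo, e1]
  by_cases h3 : x = -SInt.pos j.succ
  · rw [h3, sPerm_neg, sPerm_neg, sPerm_neg, e1, sPerm_neg, sPerm_hi, e2]
  by_cases h4 : x = -lo j
  · rw [h4, sPerm_neg, sPerm_neg, sPerm_neg, e2, sPerm_neg, sPerm_lo, e1]
  rw [Subtype.ext_iff] at h1 h2 h3 h4
  simp only [SInt.coe_neg] at h3 h4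
  rw [sPerm_fix j x (by omega), sPerm_fix j]
  have := coe_sPerm i x
  split_ifs at this <;> omega

theorem s_braid3 {n : ℕ} (i j : Fin n) (hi : 1 ≤ (i : ℕ)) (hj : (j : ℕ) = i + 1)
    (γ : SignedPerm n) : γ * s i * s j * s i = γ * s j * s i * s j := by
  simp only [mul_assoc]; congr 1
  apply Subtype.ext; refine Equiv.ext fun x => ?_
  change sPerm i (sPerm j (sPerm i x)) = sPerm j (sPerm i (sPerm j x))
  have hq : lo j = SInt.pos i.succ := by
    apply Subtype.ext; unfold lo; simp [hj]
  have c1 := coe_lo i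
  have c2 := coe_hi i
  have c4 := coe_hi j
  have e1 := sPerm_lo i
  have e2 := sPerm_hi i
  have e3 : sPerm i (SInt.pos j.succ) = SInt.pos j.succ := sPerm_fix _ _ (by omega)
  have e4 := sPerm_lo j
  have e5 := sPerm_hi j
  have e6 : sPerm j (lo i) = lo i := sPerm_fix _ _ (by omega)
  rw [hq] at e4 e5
  by_cases h1 : x = lo i
  · simp only [h1, e1, e2, e3, e4, e5, e6]
  by_cases h2 : x = SInt.pos i.succ
  · simp only [h2, e1, e2, e3, e4, e5, e6]
  by_cases h3 : x = SInt.pos j.succ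
  · simp only [h3, e1, e2, e3, e4, e5, e6]
  by_cases h4 : x = -lo i
  · simp only [h4, sPerm_neg, e1, e2, e3, e4, e5, e6]
  by_cases h5 : x = -SInt.pos i.succ
  · simp only [h5, sPerm_neg, e1, e2, e3, e4, e5, e6]
  by_cases h6 : x = -SInt.pos j.succ
  · simp only [h6, sPerm_neg, e1, e2, e3, e4, e5, e6]
  rw [Subtype.ext_iff] at h1 h2 h3 h4 h5 h6
  simp only [SInt.coe_neg] at h4 h5 h6
  have f1 : sPerm i x = x := sPerm_fix _ _ (by omega)
  have f2 : sPerm j x = x := sPerm_fix _ _ (by omega)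
  simp only [f1, f2]

theorem s_braid4 {n : ℕ} (i j : Fin n) (hi : (i : ℕ) = 0) (hj : (j : ℕ) = 1)
    (γ : SignedPerm n) : γ * s i * s j * s i * s j = γ * s j * s i * s j * s i := by
  simp only [mul_assoc]; congr 1
  apply Subtype.ext; refine Equiv.ext fun x => ?_
  change sPerm i (sPerm j (sPerm i (sPerm j x))) = sPerm j (sPerm i (sPerm j (sPerm i x)))
  have hq : lo j = SInt.pos i.succ := by
    apply Subtype.ext; unfold lo; simp [hj, hi]
  have hp : lo i = -SInt.pos i.succ := by unfold lo; simp [hi]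
  have c2 := coe_hi i
  have c4 := coe_hi j
  have e1 := sPerm_hi i
  have e3 : sPerm i (SInt.pos j.succ) = SInt.pos j.succ := sPerm_fix _ _ (by omega)
  have e4 := sPerm_lo j
  have e5 := sPerm_hi j
  rw [hp] at e1
  rw [hq] at e4 e5
  by_cases h2 : x = SInt.pos i.succ
  · simp only [h2, sPerm_neg, SInt.neg_neg, e1, e3, e4, e5]
  by_cases h3 : x = SInt.pos j.succ
  · simp only [h3, sPerm_neg, SInt.neg_neg, e1, e3, e4, e5]
  by_cases h5 : x = -SInt.pos i.succ
  · simp only [h5, sPerm_neg, SInt.neg_neg, e1, e3, e4, e5]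
  by_cases h6 : x = -SInt.pos j.succ
  · simp only [h6, sPerm_neg, SInt.neg_neg, e1, e3, e4, e5]
  rw [Subtype.ext_iff] at h2 h3 h5 h6
  simp only [SInt.coe_neg] at h5 h6
  have f1 : sPerm i x = x := sPerm_fix _ _ (by omega)
  have f2 : sPerm j x = x := sPerm_fix _ _ (by omega)
  simp only [f1, f2]

theorem bigOps_quad {n : ℕ} (P : BPoset n) (i : Fin n) (v : SignedPerm n →₀ ℂ) :
    bigOp P i (bigOp P i v) = -bigOp P i v := by
  classical
  refine end_ext (f := bigOp P i * bigOp P i) (g := -bigOp P i) (fun γ => ?_) v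
  rw [Module.End.mul_apply, LinearMap.neg_apply]
  rcases lt_cases P γ (x := lo i) (y := SInt.pos i.succ)
    (ne_of_lt (Subtype.coe_lt_coe.2 (lo_lt i))) with ⟨a, b, c | c⟩ | ⟨a, b, c⟩ <;>
  simp only [bigOp_single, gt_iff_lt, mul_s_apply, sPerm_lo, sPerm_hi, a, b, c, if_true, if_false,
    map_neg, map_zero, neg_zero]

theorem bigOps_comm {n : ℕ} (P : BPoset n) (i j : Fin n) (hij : (i : ℕ) + 2 ≤ j)
    (v : SignedPerm n →₀ ℂ) : bigOp P i (bigOp P j v) = bigOp P j (bigOp P i v) := by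
  classical
  refine end_ext (f := bigOp P i * bigOp P j) (g := bigOp P j * bigOp P i) (fun γ => ?_) v
  have hc := s_comm i j hij γ
  have hj0 : (j : ℕ) ≠ 0 := by omega
  have cl : ((lo j : SInt n) : ℤ) = j := by unfold lo; simp [hj0]
  have cl' : ((lo i : SInt n) : ℤ) = if (i : ℕ) = 0 then -1 else (i : ℤ) := by
    unfold lo; split_ifs <;> simp_all
  have ch : ((SInt.pos j.succ : SInt n) : ℤ) = j + 1 := by simp
  have ch' : ((SInt.pos i.succ : SInt n) : ℤ) = i + 1 := by simp
  have e1 : sPerm i (SInt.pos j.succ) = SInt.pos j.succ := sPerm_fix _ _ (by omega)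
  have e2 : sPerm i (lo j) = lo j := sPerm_fix _ _ (by omega)
  have e3 : sPerm j (SInt.pos i.succ) = SInt.pos i.succ := sPerm_fix _ _ (by omega)
  have e4 : sPerm j (lo i) = lo i := sPerm_fix _ _ (by split_ifs at cl' <;> omega)
  rw [Module.End.mul_apply, Module.End.mul_apply]
  rcases lt_cases P γ (x := lo i) (y := SInt.pos i.succ)
    (ne_of_lt (Subtype.coe_lt_coe.2 (lo_lt i))) with ⟨a, b, c | c⟩ | ⟨a, b, c⟩ <;>
  rcases lt_cases P γ (x := lo j) (y := SInt.pos j.succ)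
    (ne_of_lt (Subtype.coe_lt_coe.2 (lo_lt j))) with ⟨a', b', c' | c'⟩ | ⟨a', b', c'⟩ <;>
  simp only [gt_iff_lt, a, b, c, a', b', c', if_true, if_false, map_neg, map_zero, bigOp_single,
    mul_s_apply, e1, e2, e3, e4, neg_zero, hc]

set_option maxHeartbeats 1600000 in
theorem bigOps_braid3 {n : ℕ} (P : BPoset n) (i j : Fin n) (hi : 1 ≤ (i : ℕ))
    (hj : (j : ℕ) = i + 1) (v : SignedPerm n →₀ ℂ) :
    bigOp P i (bigOp P j (bigOp P i v)) = bigOp P j (bigOp P i (bigOp P j v)) := by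
  classical
  refine end_ext (f := bigOp P i * bigOp P j * bigOp P i)
    (g := bigOp P j * bigOp P i * bigOp P j) (fun γ => ?_) v
  have hc := s_braid3 i j hi hj γ
  have hi0 : (i : ℕ) ≠ 0 := by omega
  have hq : lo j = SInt.pos i.succ := by
    apply Subtype.ext; unfold lo; simp [hj]
  obtain ⟨p, hp⟩ : ∃ p, p = lo i := ⟨_, rfl⟩
  obtain ⟨q, hq'⟩ : ∃ q : SInt n, q = SInt.pos i.succ := ⟨_, rfl⟩
  obtain ⟨r, hr'⟩ : ∃ r : SInt n, r = SInt.pos j.succ := ⟨_, rfl⟩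
  have cp : (p : ℤ) = i := by rw [hp]; unfold lo; simp [hi0]
  have cq : (q : ℤ) = i + 1 := by rw [hq']; simp
  have cr : (r : ℤ) = i + 2 := by rw [hr']; simp [hj]; ring
  have e1 : sPerm i p = q := by rw [hp, hq']; exact sPerm_lo i
  have e2 : sPerm i q = p := by rw [hp, hq']; exact sPerm_hi i
  have e3 : sPerm i r = r := sPerm_fix _ _ (by omega)
  have e4 : sPerm j q = r := by rw [hq', hr', ← hq]; exact sPerm_lo j
  have e5 : sPerm j r = q := by rw [hq', hr', ← hq]; exact sPerm_hi j
  have e6 : sPerm j p = p := sPerm_fix _ _ (by omega)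
  have Ti : ∀ δ : SignedPerm n, bigOp P i (Finsupp.single δ 1) =
    if δ.1 q < δ.1 p then -Finsupp.single δ 1
    else if P.le (δ.1 p) (δ.1 q) then 0 else Finsupp.single (δ * s i) 1 := by
    intro δ; rw [hp, hq']; exact bigOp_single P i δ
  have Tj : ∀ δ : SignedPerm n, bigOp P j (Finsupp.single δ 1) =
    if δ.1 r < δ.1 q then -Finsupp.single δ 1
    else if P.le (δ.1 q) (δ.1 r) then 0 else Finsupp.single (δ * s j) 1 := by
    intro δ; rw [hr', hq', ← hq]; exact bigOp_single P j δ
  simp only [Module.End.mul_apply]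
  rcases lt_cases P γ (x := p) (y := q) (by omega) with ⟨a1, b1, c1⟩ | ⟨a1, b1, c1⟩ <;>
  rcases lt_cases P γ (x := q) (y := r) (by omega) with ⟨a2, b2, c2⟩ | ⟨a2, b2, c2⟩ <;>
  rcases lt_cases P γ (x := p) (y := r) (by omega) with ⟨a3, b3, c3⟩ | ⟨a3, b3, c3⟩ <;>
  first
  | exact absurd (a1.trans (a2.trans a3)) (lt_irrefl _)
  | exact absurd (a3.trans (a2.trans a1)) (lt_irrefl _)
  | rcases c1 with c1 | c1 <;> rcases c2 with c2 | c2 <;> rcases c3 with c3 | c3 <;>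
    simp only [Ti, Tj, mul_s_apply, e1, e2, e3, e4, e5, e6, a1, a2, a3, b1, b2, b3,
      c1, c2, c3, if_true, if_false, map_neg, map_zero, neg_zero, neg_neg, hc]

set_option maxHeartbeats 1600000 in
theorem bigOps_braid4 {n : ℕ} (P : BPoset n) (i j : Fin n) (hi : (i : ℕ) = 0)
    (hj : (j : ℕ) = 1) (v : SignedPerm n →₀ ℂ) :
    bigOp P j (bigOp P i (bigOp P j (bigOp P i v))) =
      bigOp P i (bigOp P j (bigOp P i (bigOp P j v))) := by
  classical
  refine end_ext (f := bigOp P j * bigOp P i * bigOp P j * bigOp P i)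
    (g := bigOp P i * bigOp P j * bigOp P i * bigOp P j) (fun γ => ?_) v
  have hc := s_braid4 i j hi hj γ
  have hq : lo j = SInt.pos i.succ := by
    apply Subtype.ext; unfold lo; simp [hj, hi]
  have hp : lo i = -SInt.pos i.succ := by unfold lo; simp [hi]
  obtain ⟨p, hp'⟩ : ∃ p : SInt n, p = SInt.pos i.succ := ⟨_, rfl⟩
  obtain ⟨q, hq'⟩ : ∃ q : SInt n, q = SInt.pos j.succ := ⟨_, rfl⟩
  rw [← hp'] at hp hq
  have cp : (p : ℤ) = 1 := by rw [hp']; simp [hi]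
  have cq : (q : ℤ) = 2 := by rw [hq']; simp [hj]
  have e1 : sPerm i p = -p := by rw [← hp, hp']; exact sPerm_hi i
  have e2 : sPerm i (-p) = p := by rw [← hp, hp']; exact sPerm_lo i
  have e3 : sPerm i q = q := sPerm_fix _ _ (by omega)
  have e3' : sPerm i (-q) = -q := by rw [sPerm_neg, e3]
  have e4 : sPerm j p = q := by rw [← hq, hq']; exact sPerm_lo j
  have e5 : sPerm j q = p := by rw [← hq, hq']; exact sPerm_hi j
  have e4' : sPerm j (-p) = -q := by rw [sPerm_neg, e4]
  have e5' : sPerm j (-q) = -p := by rw [sPerm_neg, e5]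
  have Ti : ∀ δ : SignedPerm n, bigOp P i (Finsupp.single δ 1) =
    if δ.1 p < δ.1 (-p) then -Finsupp.single δ 1
    else if P.le (δ.1 (-p)) (δ.1 p) then 0 else Finsupp.single (δ * s i) 1 := by
    intro δ; rw [← hp, hp']; exact bigOp_single P i δ
  have Tj : ∀ δ : SignedPerm n, bigOp P j (Finsupp.single δ 1) =
    if δ.1 q < δ.1 p then -Finsupp.single δ 1
    else if P.le (δ.1 p) (δ.1 q) then 0 else Finsupp.single (δ * s j) 1 := by
    intro δ; rw [← hq, hq']; exact bigOp_single P j δ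
  have nn : ∀ x y : SInt n, γ.1 (-x) < γ.1 (-y) ↔ γ.1 y < γ.1 x := by
    intro x y
    rw [γ.2, γ.2, ← Subtype.coe_lt_coe, ← Subtype.coe_lt_coe, SInt.coe_neg, SInt.coe_neg,
      neg_lt_neg_iff]
  have n1 := nn p q
  have n2 := nn q p
  have n3 := nn p (-q)
  have n4 := nn (-q) p
  have m1 := le_neg_apply P γ p q
  have m2 := le_neg_apply P γ q p
  have m3 := le_neg_apply P γ p (-q)
  have m4 := le_neg_apply P γ (-q) p
  rw [SInt.neg_neg] at n3 n4 m3 m4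
  have f1 := γ.2 p
  have f2 := γ.2 q
  rw [Subtype.ext_iff, SInt.coe_neg] at f1 f2
  simp only [Module.End.mul_apply]
  rcases lt_cases P γ (x := -p) (y := p) (by rw [SInt.coe_neg]; omega) with
    ⟨a1, b1, c1⟩ | ⟨a1, b1, c1⟩ <;>
  rcases lt_cases P γ (x := p) (y := q) (by omega) with
    ⟨a2, b2, c2⟩ | ⟨a2, b2, c2⟩ <;>
  rcases lt_cases P γ (x := -p) (y := q) (by rw [SInt.coe_neg]; omega) with
    ⟨a3, b3, c3⟩ | ⟨a3, b3, c3⟩ <;>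
  rcases lt_cases P γ (x := -q) (y := q) (by rw [SInt.coe_neg]; omega) with
    ⟨a4, b4, c4⟩ | ⟨a4, b4, c4⟩ <;>
  first
  | (exfalso
     clear c1 c2 c3 c4 Ti Tj
     rw [← Subtype.coe_lt_coe] at a1 a2 a3 a4
     omega)
  | rcases c1 with c1 | c1 <;> rcases c2 with c2 | c2 <;> rcases c3 with c3 | c3 <;>
    rcases c4 with c4 | c4 <;>
    simp only [Ti, Tj, mul_s_apply, e1, e2, e3, e4, e5, e3', e4', e5', n1, n2, ← n3, ← n4,
      m1, m2, ← m3, ← m4, a1, a2, a3, a4, b1, b2, b3, b4,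
      c1, c2, c3, c4, if_true, if_false, map_neg, map_zero, neg_zero, neg_neg, hc]

theorem posetOps {n : ℕ} (P : BPoset n) : HeckeOps (posetOp P) := by
  have inj : Function.Injective
      (Finsupp.mapDomain Subtype.val : (sigmaB P →₀ ℂ) → (SignedPerm n →₀ ℂ)) :=
    Finsupp.mapDomain_injective Subtype.val_injective
  constructor
  · intro i v; apply inj
    have : Finsupp.mapDomain Subtype.val (-posetOp P i v) =
        -Finsupp.mapDomain Subtype.val (posetOp P i v) :=
      map_neg (Finsupp.lmapDomain ℂ ℂ Subtype.val) _
    simpa only [mapDomain_posetOp, this] using bigOps_quad P i _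
  · intro i j h h' v; apply inj
    simpa only [mapDomain_posetOp] using bigOps_braid3 P i j h h' _
  · intro i j h v; apply inj
    simpa only [mapDomain_posetOp] using bigOps_comm P i j h _
  · intro i j h h' v; apply inj
    simpa only [mapDomain_posetOp] using bigOps_braid4 P i j h h' _

/-- The `B_n` poset module `M^B_P`, with underlying space `ℂ Σ^B_R(P)`. -/
def posetModule {n : ℕ} (P : BPoset n) : FDMod (HeckeB n) :=
  heckeModule (sigmaB P →₀ ℂ) (posetOps P)

/-- The basis `Σ^B_R(P)` of `M^B_P`. -/
def posetBasis {n : ℕ} (P : BPoset n) : Module.Basis (sigmaB P) ℂ (posetModule P) :=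
  (Finsupp.basisSingleOne : Module.Basis (sigmaB P) ℂ (sigmaB P →₀ ℂ))

/-! ### Simple modules, and the type-`B` quasisymmetric characteristic -/

/-- The operators of the one-dimensional module `F_I`: `π̄_i` acts by `-1` if `i ∈ I` and by `0`
otherwise. -/
def simpleOp {n : ℕ} (I : Finset (Fin n)) (i : Fin n) : Module.End ℂ ℂ :=
  if i ∈ I then -1 else 0

theorem simpleOp_apply {n : ℕ} (I : Finset (Fin n)) (i : Fin n) (z : ℂ) :
    simpleOp I i z = (if i ∈ I then -1 else 0) * z := by
  unfold simpleOp; split_ifs <;> simp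

theorem simpleOps {n : ℕ} (I : Finset (Fin n)) : HeckeOps (simpleOp I) := by
  constructor <;> intros <;> simp only [simpleOp_apply] <;> split_ifs <;> ring

/-- The irreducible right `H_n^B(0)`-module `F^B_I` for `I ⊆ [0, n - 1]`. -/
def simpleModule {n : ℕ} (I : Finset (Fin n)) : FDMod (HeckeB n) :=
  heckeModule ℂ (simpleOps I)

section Eigenvector

variable {n : ℕ} {V : Type} [AddCommGroup V] [Module ℂ V] {T : Fin n → Module.End ℂ V}

/-- `v` is killed or negated by `T i`. -/
def IsEig (T : Fin n → Module.End ℂ V) (v : V) (i : Fin n) : Prop :=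
  T i v = 0 ∨ T i v = -v

theorem IsEig.of_comm (hT : HeckeOps T) {v : V} {i c : Fin n}
    (h : (i : ℕ) + 2 ≤ c ∨ (c : ℕ) + 2 ≤ i) (hv : IsEig T v i) : IsEig T (T c v) i := by
  have e : T i (T c v) = T c (T i v) := by
    rcases h with h | h
    · exact hT.comm i c h v
    · exact (hT.comm c i h v).symm
  rcases hv with hv | hv
  · left; rw [e, hv, map_zero]
  · right; rw [e, hv, map_neg]

/-- One step of the construction of a common eigenvector: from an eigenvector of `T_s`, `s < k`,
to an eigenvector of `T_s`, `s ≤ k`. -/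
theorem exists_eig_step (hT : HeckeOps T) (k : Fin n) (v : V) (hv : v ≠ 0)
    (hk : ∀ i < k, IsEig T v i) : ∃ w ≠ 0, ∀ i ≤ k, IsEig T w i := by
  by_contra H
  push Not at H
  have nz : ∀ (a : V) (c : Fin n), a ≠ 0 → (∀ i ≤ k, i ≠ c → IsEig T a i) → T c a ≠ 0 := by
    intro a c ha hc h0
    obtain ⟨i, hi, hi'⟩ := H a ha
    by_cases e : i = c
    · subst e; exact hi' (Or.inl h0)
    · exact hi' (hc i hi e)
  have down : ∀ d : ℕ, ∀ c : Fin n, (c : ℕ) + d = k → ∃ a : V, a ≠ 0 ∧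
      (∀ i ≤ k, i ≠ c → IsEig T a i) ∧ ∀ c' ≤ k, (c' : ℕ) = c + 1 →
        ∃ a', (∀ i ≤ k, i ≠ c' → IsEig T a' i) ∧ a = T c' a' := by
    intro d
    induction d with
    | zero =>
      intro c hc
      have hck : c = k := Fin.ext (by omega)
      subst hck
      refine ⟨v, hv, fun i hi hne => hk i (lt_of_le_of_ne hi hne), fun c' h1 h2 => ?_⟩
      rw [Fin.le_def] at h1; omega
    | succ d ih =>
      intro c hc
      obtain ⟨c1, hc1⟩ : ∃ c1 : Fin n, (c1 : ℕ) = c + 1 := ⟨⟨c + 1, by omega⟩, rfl⟩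
      obtain ⟨a, ha, hE, hmem⟩ := ih c1 (by omega)
      refine ⟨T c1 a, nz a c1 ha hE, fun i hi hne => ?_, fun c' _ h2 => ?_⟩
      · have hne' : (i : ℕ) ≠ c := fun h => hne (Fin.ext h)
        rcases (by omega : (i : ℕ) + 2 ≤ c1 ∨ (i : ℕ) = c1 ∨ (i : ℕ) = c1 + 1 ∨
          (c1 : ℕ) + 2 ≤ i) with h | h | h | h
        · exact (hE i hi (fun e => by subst e; omega)).of_comm hT (Or.inl h)
        · have e : i = c1 := Fin.ext h
          subst e; right; exact hT.quad _ _
        · obtain ⟨a', hE', rfl⟩ := hmem i hi h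
          have hb := hT.braid3 c1 i (by omega) h a'
          have h1 : IsEig T a' c1 := hE' c1 (by rw [Fin.le_def] at *; omega)
            (fun e => by subst e; omega)
          rcases h1 with h1 | h1
          · left; rw [← hb, h1]; simp
          · right; rw [← hb, h1]; simp
        · exact (hE i hi (fun e => by subst e; omega)).of_comm hT (Or.inr h)
      · have e : c' = c1 := Fin.ext (by omega)
        subst e; exact ⟨a, hE, rfl⟩
  have up : ∀ d : ℕ, ∀ c : Fin n, (c : ℕ) = d → c ≤ k → ∃ a : V, a ≠ 0 ∧
      (∀ i ≤ k, i ≠ c → IsEig T a i) ∧ ∀ i ≤ k, (i : ℕ) ≠ c + 1 → IsEig T (T c a) i := by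
    have upAux : ∀ d : ℕ, ∀ c c₀ : Fin n, (c₀ : ℕ) = d → (c : ℕ) = d + 1 → c ≤ k →
        ∃ a a' : V, a ≠ 0 ∧ (∀ i ≤ k, i ≠ c → IsEig T a i) ∧
          (∀ i ≤ k, i ≠ c₀ → IsEig T a' i) ∧ a = T c₀ a' ∧
          (d = 0 → ∃ a'', a' = T c a'' ∧ IsEig T a'' c₀) ∧
          ∀ i ≤ k, (i : ℕ) ≠ c + 1 → IsEig T (T c a) i := by
      have fin : ∀ d : ℕ, ∀ c c₀ : Fin n, (c₀ : ℕ) = d → (c : ℕ) = d + 1 → c ≤ k →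
          ∀ a a' : V, a ≠ 0 → (∀ i ≤ k, i ≠ c → IsEig T a i) →
          (∀ i ≤ k, i ≠ c₀ → IsEig T a' i) → a = T c₀ a' →
          (d = 0 → ∃ a'', a' = T c a'' ∧ IsEig T a'' c₀) →
          ∀ i ≤ k, (i : ℕ) ≠ c + 1 → IsEig T (T c a) i := by
        intro d c c₀ h0 h1 hck a a' ha hE hE' haa hm i hi hne
        rcases (by omega : (i : ℕ) + 2 ≤ c ∨ (i : ℕ) = c ∨ (i : ℕ) = c₀ ∨
          (c : ℕ) + 2 ≤ i) with h | h | h | h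
        · exact (hE i hi (fun e => by subst e; omega)).of_comm hT (Or.inl h)
        · have e : i = c := Fin.ext h
          subst e; right; exact hT.quad _ _
        · have e : i = c₀ := Fin.ext h
          subst e
          by_cases hd : d = 0
          · obtain ⟨a'', rfl, h2⟩ := hm hd
            have hb := hT.braid4 i c (by omega) (by omega) a''
            subst haa
            rcases h2 with h2 | h2
            · left; rw [← hb, h2]; simp
            · right; rw [← hb, h2]; simp
          · have hb := hT.braid3 i c (by omega) (by omega) a'
            subst haa
            rcases hE' c hck (fun e => by subst e; omega) with h2 | h2
            · left; rw [hb, h2]; simp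
            · right; rw [hb, h2]; simp
        · exact (hE i hi (fun e => by subst e; omega)).of_comm hT (Or.inr h)
      intro d
      induction d with
      | zero =>
        intro c c₀ h0 h1 hck
        have hck' := hck
        rw [Fin.le_def] at hck'
        obtain ⟨a', ha', hE', hmem⟩ := down k c₀ (by omega)
        obtain ⟨a'', hE'', e⟩ := hmem c hck (by omega)
        have hE : ∀ i ≤ k, i ≠ c → IsEig T (T c₀ a') i := by
          intro i hi hne
          have hne' : (i : ℕ) ≠ c := fun h => hne (Fin.ext h)
          by_cases h : (i : ℕ) = 0
          · have e : i = c₀ := Fin.ext (by omega)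
            subst e; right; exact hT.quad _ _
          · exact (hE' i hi (fun e => by subst e; omega)).of_comm hT (Or.inr (by omega))
        have hm : (0 = 0 → ∃ a'', a' = T c a'' ∧ IsEig T a'' c₀) := fun _ =>
          ⟨a'', e, hE'' c₀ (by rw [Fin.le_def]; omega) (fun e => by subst e; omega)⟩
        exact ⟨_, a', nz a' c₀ ha' hE', hE, hE', rfl, hm,
          fin 0 c c₀ h0 h1 hck _ a' (nz a' c₀ ha' hE') hE hE' rfl hm⟩
      | succ d ih =>
        intro c c₀ h0 h1 hck
        have hck' := hck
        rw [Fin.le_def] at hck'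
        obtain ⟨a, a', ha, hE, -, -, -, hfin⟩ := ih c₀ ⟨d, by omega⟩ rfl h0
          (by rw [Fin.le_def]; omega)
        have hE1 : ∀ i ≤ k, i ≠ c → IsEig T (T c₀ a) i := fun i hi hne =>
          hfin i hi (fun e => hne (Fin.ext (by omega)))
        have hm : (d + 1 = 0 → ∃ a'', a = T c a'' ∧ IsEig T a'' c₀) := fun h => by omega
        exact ⟨_, a, nz a c₀ ha hE, hE1, hE, rfl, hm,
          fin (d + 1) c c₀ h0 h1 hck _ a (nz a c₀ ha hE) hE1 hE rfl hm⟩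
    intro d c hcd hck
    have hck' := hck
    rw [Fin.le_def] at hck'
    rcases Nat.eq_zero_or_pos d with rfl | hd
    · obtain ⟨a, ha, hE, -⟩ := down k c (by omega)
      refine ⟨a, ha, hE, fun i hi hne => ?_⟩
      by_cases h : (i : ℕ) = 0
      · have e : i = c := Fin.ext (by omega)
        subst e; right; exact hT.quad _ _
      · exact (hE i hi (fun e => by subst e; omega)).of_comm hT (Or.inr (by omega))
    · obtain ⟨a, a', ha, hE, -, -, -, hfin⟩ := upAux (d - 1) c ⟨d - 1, by omega⟩ rfl (by omega) hck
      exact ⟨a, ha, hE, hfin⟩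
  obtain ⟨a, ha, hE, hE'⟩ := up k k rfl le_rfl
  obtain ⟨i, hi, hi'⟩ := H _ (nz a k ha hE)
  exact hi' (hE' i hi (by rw [Fin.le_def] at hi; omega))

theorem exists_eig (hT : HeckeOps T) [Nontrivial V] : ∃ v : V, v ≠ 0 ∧ ∀ i, IsEig T v i := by
  have : ∀ k : ℕ, k ≤ n → ∃ v : V, v ≠ 0 ∧ ∀ i : Fin n, (i : ℕ) < k → IsEig T v i := by
    intro k
    induction k with
    | zero =>
      intro _
      obtain ⟨v, hv⟩ := exists_ne (0 : V)
      exact ⟨v, hv, fun i hi => by omega⟩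
    | succ k ih =>
      intro hk
      obtain ⟨v, hv, hE⟩ := ih (by omega)
      obtain ⟨w, hw, hE'⟩ := exists_eig_step hT ⟨k, hk⟩ v hv (fun i hi => hE i hi)
      exact ⟨w, hw, fun i hi => hE' i (by rw [Fin.le_def]; change (i : ℕ) ≤ k; omega)⟩
  obtain ⟨v, hv, hE⟩ := this n le_rfl
  exact ⟨v, hv, fun i => hE i i.2⟩

end Eigenvector

/-! #### The classes of the simple modules form a basis of the Grothendieck group -/

theorem G0.mk_eq_add {A : Type} [Ring A] [Algebra ℂ A] {M' M M'' : FDMod A}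
    (h : IsShortExact M' M M'') : G0.mk M = G0.mk M' + G0.mk M'' := by
  rw [← sub_eq_zero, ← sub_sub]
  exact (QuotientAddGroup.eq_zero_iff _).2 (AddSubgroup.subset_closure ⟨M', M, M'', h, rfl⟩)

/-- Additive functions on modules factor through the Grothendieck group. -/
def G0.lift {A B : Type} [Ring A] [Algebra ℂ A] [AddCommGroup B] (φ : FDMod A → B)
    (h : ∀ M' M M'' : FDMod A, IsShortExact M' M M'' → φ M = φ M' + φ M'') : G0 A →+ B :=
  QuotientAddGroup.lift (k0Rels A) (FreeAbelianGroup.lift φ) (by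
    rw [k0Rels, AddSubgroup.closure_le]
    rintro _ ⟨M', M, M'', hs, rfl⟩
    simp [h M' M M'' hs])

@[simp] theorem G0.lift_mk {A B : Type} [Ring A] [Algebra ℂ A] [AddCommGroup B] (φ : FDMod A → B)
    (h : ∀ M' M M'' : FDMod A, IsShortExact M' M M'' → φ M = φ M' + φ M'') (M : FDMod A) :
    G0.lift φ h (G0.mk M) = φ M := by
  unfold G0.lift G0.mk
  rw [QuotientAddGroup.lift_mk, FreeAbelianGroup.lift_apply_of]

/-- The trace of `a` on a module. -/
def trOn {A : Type} [Ring A] [Algebra ℂ A] (a : A) (M : FDMod A) : ℂ :=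
  LinearMap.trace ℂ M (Algebra.lsmul ℂ ℂ M (MulOpposite.op a))

theorem trOn_add {A : Type} [Ring A] [Algebra ℂ A] (a : A) (M' M M'' : FDMod A)
    (h : IsShortExact M' M M'') : trOn a M = trOn a M' + trOn a M'' := by
  obtain ⟨f, g, hf, hfg, hg⟩ := h
  let f' : M' →ₗ[ℂ] M := f.restrictScalars ℂ
  let g' : M →ₗ[ℂ] M'' := g.restrictScalars ℂ
  obtain ⟨t, ht⟩ := g'.exists_rightInverse_of_surjective (LinearMap.range_eq_top.2 hg)
  obtain ⟨r, hr⟩ := f'.exists_leftInverse_of_injective (LinearMap.ker_eq_bot.2 hf)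
  have ht' : ∀ x, g (t x) = x := fun x => LinearMap.congr_fun ht x
  have hr' : ∀ x, r (f x) = x := fun x => LinearMap.congr_fun hr x
  have hgf : ∀ x, g (f x) = 0 := fun x => (hfg (f x)).2 ⟨x, rfl⟩
  let X := Algebra.lsmul ℂ ℂ M (MulOpposite.op a)
  let r' : M →ₗ[ℂ] M' := r ∘ₗ (LinearMap.id - t ∘ₗ g')
  have e : X = (X ∘ₗ f') ∘ₗ r' + (X ∘ₗ t) ∘ₗ g' := by
    ext x
    have : g (x - t (g x)) = 0 := by rw [map_sub, ht', sub_self]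
    obtain ⟨y, hy⟩ := (hfg _).1 this
    have h1 : f (r' x) = x - t (g x) := by
      change f (r (x - t (g x))) = _
      rw [← hy, hr']
    change X x = X (f (r' x)) + X (t (g x))
    rw [h1, ← map_add]; simp
  change LinearMap.trace ℂ M X = _
  rw [e, map_add, LinearMap.trace_comp_comm' r' (X ∘ₗ f'), LinearMap.trace_comp_comm' g' (X ∘ₗ t)]
  congr 1
  · unfold trOn; congr 1; ext x
    change r (MulOpposite.op a • f x - t (g (MulOpposite.op a • f x))) = MulOpposite.op a • x
    rw [← map_smul, hgf, map_zero, sub_zero, hr']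
  · unfold trOn; congr 1; ext x
    change g (MulOpposite.op a • t x) = MulOpposite.op a • x
    rw [map_smul, ht']

/-- An element of `H_n^B(0)` that acts by `1` on `F_I` and by `0` on the other simple modules. -/
def sep {n : ℕ} (I : Finset (Fin n)) : HeckeB n :=
  ((List.finRange n).map fun i => if i ∈ I then -opi i else 1 + opi i).prod

theorem trOn_sep {n : ℕ} (I J : Finset (Fin n)) :
    trOn (sep I) (simpleModule J) = if I = J then 1 else 0 := by
  have key : ∀ (l : List (Fin n)) (z : ℂ),
      (heckeRep (simpleOps J) (l.map fun i => if i ∈ I then -opi i else 1 + opi i).prod).unop z =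
        (if ∀ i ∈ l, (i ∈ I ↔ i ∈ J) then 1 else 0) * z := by
    intro l
    induction l with
    | nil => intro z; simp
    | cons i l ih =>
      intro z
      rw [List.map_cons, List.prod_cons, map_mul, MulOpposite.unop_mul, Module.End.mul_apply, ih]
      have : (heckeRep (simpleOps J) (if i ∈ I then -opi i else 1 + opi i)).unop z =
          (if i ∈ I ↔ i ∈ J then 1 else 0) * z := by
        by_cases h1 : i ∈ I <;> by_cases h2 : i ∈ J <;> simp [h1, h2, simpleOp_apply]
      rw [this]
      by_cases h1 : i ∈ I ↔ i ∈ J <;> simp [h1]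
  have h1 : Algebra.lsmul ℂ ℂ (simpleModule J) (MulOpposite.op (sep I)) =
      (if I = J then 1 else 0 : ℂ) • (LinearMap.id : ℂ →ₗ[ℂ] ℂ) := by
    refine LinearMap.ext fun z => ?_
    refine (key (List.finRange n) z).trans ?_
    by_cases h : I = J
    · subst h; simp; exact one_mul (show ℂ from z)
    · have h' : ¬ ∀ i, i ∈ I ↔ i ∈ J := fun hh => h (Finset.ext hh)
      simp [h, h']; exact zero_mul (show ℂ from z)
  unfold trOn
  rw [h1]
  change LinearMap.trace ℂ ℂ _ = _
  rw [map_smul, LinearMap.trace_id]; simp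

theorem linearIndependent_simple (n : ℕ) :
    LinearIndependent ℤ (fun I : Finset (Fin n) => G0.mk (simpleModule I)) := by
  rw [Fintype.linearIndependent_iff]
  intro g hg J
  have := congrArg (G0.lift (trOn (sep J)) (trOn_add (sep J))) hg
  rw [map_sum, map_zero] at this
  simp only [map_zsmul, G0.lift_mk, trOn_sep] at this
  simpa using this

theorem moduleOps {n : ℕ} (M : FDMod (HeckeB n)) :
    HeckeOps (V := M) (fun i : Fin n => Algebra.lsmul ℂ ℂ M (MulOpposite.op (opi i : HeckeB n))) := by
  have rel : ∀ x y, HeckeRel n x y →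
      RingQuot.mkAlgHom ℂ (HeckeRel n) x = RingQuot.mkAlgHom ℂ (HeckeRel n) y :=
    fun x y h => RingQuot.mkAlgHom_rel ℂ h
  constructor
  · intro i v
    have := rel _ _ (.quad i)
    simp only [map_mul, map_neg] at this
    simp only [Algebra.lsmul_coe, ← mul_smul, ← MulOpposite.op_mul, ← neg_smul,
      ← MulOpposite.op_neg]
    exact congrArg (fun a => MulOpposite.op a • v) this
  · intro i j h h' v
    have := rel _ _ (.braid3 i j h h')
    simp only [map_mul, mul_assoc] at this
    simp only [Algebra.lsmul_coe, ← mul_smul, ← MulOpposite.op_mul, mul_assoc]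
    exact congrArg (fun a => MulOpposite.op a • v) this
  · intro i j h v
    have := rel _ _ (.comm i j h)
    simp only [map_mul] at this
    simp only [Algebra.lsmul_coe, ← mul_smul, ← MulOpposite.op_mul]
    exact congrArg (fun a => MulOpposite.op a • v) this.symm
  · intro i j h h' v
    have := rel _ _ (.braid4 i j h h')
    simp only [map_mul, mul_assoc] at this
    simp only [Algebra.lsmul_coe, ← mul_smul, ← MulOpposite.op_mul, mul_assoc]
    exact congrArg (fun a => MulOpposite.op a • v) this

/-- A common eigenvector spans a simple submodule. -/
theorem exists_simple {n : ℕ} (M : FDMod (HeckeB n)) [Nontrivial M] :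
    ∃ (I : Finset (Fin n)) (f : simpleModule I →ₗ[(HeckeB n)ᵐᵒᵖ] M), Function.Injective f := by
  classical
  obtain ⟨v, hv, hE⟩ : ∃ v : M, v ≠ 0 ∧ ∀ i, IsEig (V := M)
      (fun i : Fin n => Algebra.lsmul ℂ ℂ M (MulOpposite.op (opi i : HeckeB n))) v i :=
    exists_eig (moduleOps M)
  let I : Finset (Fin n) := Finset.univ.filter fun i => MulOpposite.op (opi i) • v = -v
  have hI : ∀ i, MulOpposite.op (opi i) • v = (if i ∈ I then -1 else 0 : ℂ) • v := by
    intro i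
    by_cases h : MulOpposite.op (opi i) • v = -v
    · simp [I, h]
    · have : MulOpposite.op (opi i) • v = 0 := (hE i).resolve_right h
      simp only [I, Finset.mem_filter, Finset.mem_univ, true_and, if_neg h, zero_smul]
      exact this
  have key : ∀ (a : HeckeB n) (z : ℂ), MulOpposite.op a • (z • v) =
      ((heckeRep (simpleOps I) a).unop z) • v := by
    intro a
    obtain ⟨x, rfl⟩ := RingQuot.mkAlgHom_surjective ℂ (HeckeRel n) a
    induction x using FreeAlgebra.induction with
    | grade0 r =>
      intro z
      rw [AlgHom.commutes, AlgHom.commutes, MulOpposite.algebraMap_apply, MulOpposite.unop_op,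
        Module.algebraMap_end_apply, ← MulOpposite.algebraMap_apply, algebraMap_smul, smul_smul,
        smul_eq_mul]
    | grade1 i =>
      intro z
      change MulOpposite.op (opi i) • (z • v) = ((heckeRep (simpleOps I) (opi i)).unop z) • v
      rw [heckeRep_opi, MulOpposite.unop_op, simpleOp_apply, smul_comm, hI, smul_smul, mul_comm]
    | mul x y hx hy =>
      intro z
      rw [map_mul, MulOpposite.op_mul, mul_smul, hx, hy, map_mul, MulOpposite.unop_mul,
        Module.End.mul_apply]
    | add x y hx hy =>
      intro z
      rw [map_add, MulOpposite.op_add, add_smul, hx, hy, map_add, MulOpposite.unop_add,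
        LinearMap.add_apply, add_smul]
  let f : simpleModule I →ₗ[(HeckeB n)ᵐᵒᵖ] M :=
    { toFun := fun z => (show ℂ from z) • v
      map_add' := fun x y => add_smul (R := ℂ) x y v
      map_smul' := fun a z => (key a.unop z).symm }
  refine ⟨I, f, fun x y hxy => ?_⟩
  have hxy' : (show ℂ from x) • v = (show ℂ from y) • v := hxy
  exact smul_left_injective ℂ hv hxy'

theorem span_simple (n : ℕ) :
    ⊤ ≤ Submodule.span ℤ (Set.range fun I : Finset (Fin n) => G0.mk (simpleModule I)) := by
  have main : ∀ (d : ℕ) (M : FDMod (HeckeB n)), Module.finrank ℂ M = d → G0.mk M ∈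
      Submodule.span ℤ (Set.range fun I : Finset (Fin n) => G0.mk (simpleModule I)) := by
    intro d
    induction d using Nat.strong_induction_on with
    | _ d ih =>
      intro M hM
      rcases subsingleton_or_nontrivial M with hs | hs
      · have : IsShortExact M M M := ⟨0, 0, fun x y _ => Subsingleton.elim _ _,
          fun x => ⟨fun _ => ⟨0, Subsingleton.elim _ _⟩, fun _ => Subsingleton.elim _ _⟩,
          fun x => ⟨0, Subsingleton.elim _ _⟩⟩
        have h := G0.mk_eq_add this
        rw [left_eq_add] at h
        rw [h]; exact Submodule.zero_mem _
      · obtain ⟨I, f, hf⟩ := exists_simple M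
        let N := LinearMap.range f
        have : Module.Finite ℂ (M ⧸ N) :=
          Module.Finite.of_surjective (N.mkQ.restrictScalars ℂ) (Submodule.mkQ_surjective N)
        let Q : FDMod (HeckeB n) := { carrier := M ⧸ N }
        have hex : IsShortExact (simpleModule I) M Q :=
          ⟨f, N.mkQ, hf, LinearMap.exact_map_mkQ_range f, Submodule.mkQ_surjective N⟩
        have hlt : Module.finrank ℂ Q < d := by
          let g : M →ₗ[ℂ] Q := N.mkQ.restrictScalars ℂ
          have hr := LinearMap.finrank_range_add_finrank_ker g
          have hg : LinearMap.range g = ⊤ := LinearMap.range_eq_top.2 (Submodule.mkQ_surjective N)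
          rw [hg, finrank_top, hM] at hr
          have hx : f (1 : ℂ) ∈ LinearMap.ker g := by
            change N.mkQ (f (1 : ℂ)) = 0
            rw [Submodule.mkQ_apply, Submodule.Quotient.mk_eq_zero]
            exact ⟨_, rfl⟩
          have hne : f (1 : ℂ) ≠ 0 := fun h => one_ne_zero (α := ℂ) (hf (h.trans (map_zero f).symm))
          have : Nontrivial (LinearMap.ker g) :=
            ⟨⟨⟨_, hx⟩, 0, fun h => hne (congrArg Subtype.val h)⟩⟩
          have := Module.finrank_pos (R := ℂ) (M := LinearMap.ker g)
          omega
        rw [G0.mk_eq_add hex]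
        exact Submodule.add_mem _ (Submodule.subset_span ⟨I, rfl⟩) (ih _ hlt Q rfl)
  rintro x -
  obtain ⟨x, rfl⟩ := QuotientAddGroup.mk_surjective x
  induction x using FreeAbelianGroup.induction_on with
  | zero => exact Submodule.zero_mem _
  | of M => exact main _ M rfl
  | neg M h => exact Submodule.neg_mem _ h
  | add x y hx hy => exact Submodule.add_mem _ hx hy

/-- The classes `[F_I]`, `I ⊆ [0, n - 1]`, form a `ℤ`-basis of `G_0(H_n^B(0))`. -/
def simpleBasis (n : ℕ) : Module.Basis (Finset (Fin n)) ℤ (G0 (HeckeB n)) :=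
  Module.Basis.mk (linearIndependent_simple n) (span_simple n)

theorem simpleBasis_apply {n : ℕ} (I : Finset (Fin n)) :
    simpleBasis n I = G0.mk (simpleModule I) := Module.Basis.mk_apply _ _ _

/-- The type-`B` quasisymmetric characteristic in degree `n`: the `ℤ`-linear map
`[F_I] ↦ F^B_I`. -/
def chB (n : ℕ) : G0 (HeckeB n) →ₗ[ℤ] MvPowerSeries ℕ ℤ :=
  (simpleBasis n).constr ℤ FB

theorem chB_simple {n : ℕ} (I : Finset (Fin n)) : chB n (G0.mk (simpleModule I)) = FB I := by
  rw [← simpleBasis_apply, chB, Module.Basis.constr_basis]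

end TypeB

end

open TypeB

/-!
The action on `M^B_P` is by definition that of the operators `posetOp`. The identity
`ch^B [M^B_P] = K^B_P` holds because both sides equal `∑ F^B_{Des γ}`, summed over
`γ ∈ Σ^B_R(P)`.

*The module side* (`G0.mk_posetModule`). The generator `π̄_i` sends `γ` to `-γ` or `0`, according
to whether `i` is a descent of `γ`, up to a multiple of `γ s_i` that occurs only if `i` is an
ascent. The statistic `height γ = -∑ x * γ x` increases along ascents, so all elements of the
algebra act by triangular operators on the basis `Σ^B_R(P)`, with diagonal entries those of the
simple modules `F_{Des γ}`. Hence `M^B_P` and `⨁ F_{Des γ}` have the same traces, and the traces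
of the elements `sep J` are the coordinates in the basis of simple classes. This replaces a
composition series of `M^B_P`.

*The `P`-partition side* (`KB_eq_sum`, `KB_posetOfPerm`). Every odd `f : [-n, n] → ℤ` is sorted by
exactly one signed permutation `γ`: order the elements by the pairs `(f x, x)`,
lexicographically. An `f` sorted by `γ` is a type-`B` `P`-partition if and only if
`γ ∈ Σ^B_R(P)`. So the `P`-partitions are the disjoint union of the `P(γ)`-partitions. Reading a
`P(γ)`-partition along `γ 0, γ 1, …, γ n` gives a sequence `0 = a₀ ≤ a₁ ≤ ⋯ ≤ aₙ` with strict steps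
at the descents of `γ`. Its monomial is that of `f`, since `|γ 1|, …, |γ n|` is a permutation of
`1, …, n`.
-/

noncomputable section

namespace TypeB

/-! ### Operators that are triangular with respect to a height function -/

/-- `X` sends each basis vector `γ` to `c γ • γ` plus a combination of basis vectors of height
greater than `h γ`. -/
def IsTriangular {ι : Type} (h : ι → ℤ) (c : ι → ℂ) (X : Module.End ℂ (ι →₀ ℂ)) : Prop :=
  ∀ γ, X (Finsupp.single γ 1) - c γ • Finsupp.single γ 1 ∈ Finsupp.supported ℂ ℂ {δ | h γ < h δ}

namespace IsTriangular

variable {ι : Type} {h : ι → ℤ} {c d : ι → ℂ} {X Y : Module.End ℂ (ι →₀ ℂ)}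

theorem one : IsTriangular h (fun _ => 1) 1 := by
  intro γ; simp

theorem neg (hX : IsTriangular h c X) : IsTriangular h (fun γ => -c γ) (-X) := by
  intro γ
  have := Submodule.neg_mem _ (hX γ)
  rwa [neg_sub', ← neg_smul] at this

theorem add (hX : IsTriangular h c X) (hY : IsTriangular h d Y) :
    IsTriangular h (fun γ => c γ + d γ) (X + Y) := by
  intro γ
  have := Submodule.add_mem _ (hX γ) (hY γ)
  rwa [sub_add_sub_comm, ← add_smul] at this

theorem map_mem (hX : IsTriangular h c X) (k : ℤ) {w : ι →₀ ℂ}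
    (hw : w ∈ Finsupp.supported ℂ ℂ {δ | k < h δ}) :
    X w ∈ Finsupp.supported ℂ ℂ {δ | k < h δ} := by
  have hle : Finsupp.supported ℂ ℂ {δ | k < h δ} ≤
      (Finsupp.supported ℂ ℂ {δ | k < h δ}).comap X := by
    conv_lhs => rw [Finsupp.supported_eq_span_single]
    rw [Submodule.span_le]
    rintro _ ⟨δ, hδ, rfl⟩
    have h1 := Finsupp.supported_mono (M := ℂ) (R := ℂ) (s := {ε | h δ < h ε})
      (t := {δ | k < h δ}) (fun ε hε => lt_trans (show k < h δ from hδ) (show h δ < h ε from hε)) (hX δ)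
    have h2 : Finsupp.single δ (1 : ℂ) ∈ Finsupp.supported ℂ ℂ {δ | k < h δ} :=
      Finsupp.single_mem_supported ℂ 1 hδ
    have := Submodule.add_mem _ h1 (Submodule.smul_mem _ (c δ) h2)
    rwa [sub_add_cancel] at this
  exact hle hw

theorem mul (hX : IsTriangular h c X) (hY : IsTriangular h d Y) :
    IsTriangular h (fun γ => c γ * d γ) (X * Y) := by
  intro γ
  have h1 := hX.map_mem _ (hY γ)
  have h2 := Submodule.smul_mem _ (d γ) (hX γ)
  have := Submodule.add_mem _ h1 h2
  rwa [map_sub, map_smul, smul_sub, smul_smul, sub_add_sub_cancel, mul_comm] at this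

theorem trace_eq [Fintype ι] (hX : IsTriangular h c X) :
    LinearMap.trace ℂ (ι →₀ ℂ) X = ∑ γ, c γ := by
  classical
  rw [LinearMap.trace_eq_matrix_trace ℂ Finsupp.basisSingleOne, Matrix.trace]
  refine Finset.sum_congr rfl fun γ _ => ?_
  have h0 : (X (Finsupp.single γ 1) - c γ • Finsupp.single γ 1 : ι →₀ ℂ) γ = 0 := by
    by_contra hne
    exact lt_irrefl (h γ) ((Finsupp.mem_supported ℂ _).1 (hX γ) (Finsupp.mem_support_iff.2 hne))
  rw [Matrix.diag_apply, LinearMap.toMatrix_apply, Finsupp.coe_basisSingleOne,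
    Finsupp.basisSingleOne_repr, LinearEquiv.refl_apply]
  simpa [sub_eq_zero] using h0

end IsTriangular

/-! ### The class of the poset module -/

theorem posetOp_single {n : ℕ} (P : BPoset n) (i : Fin n) (γ : sigmaB P) :
    posetOp P i (Finsupp.single γ 1) = open Classical in
      if IsDescent γ.1 i then -Finsupp.single γ 1
      else if h : γ.1 * s i ∈ sigmaB P then Finsupp.single ⟨γ.1 * s i, h⟩ 1 else 0 := by
  rw [posetOp, Finsupp.linearCombination_single, one_smul]

/-- The right descent set of `γ`, as a subset of `[0, n - 1]`. -/
def descents {n : ℕ} (γ : SignedPerm n) : Finset (Fin n) :=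
  open Classical in Finset.univ.filter fun i => IsDescent γ i

theorem mem_descents {n : ℕ} {γ : SignedPerm n} {i : Fin n} :
    i ∈ descents γ ↔ IsDescent γ i := by simp [descents]

/-- A height function on signed permutations that increases along ascents. It plays the role of
the length function. -/
def height {n : ℕ} (γ : SignedPerm n) : ℤ := -∑ x : SInt n, (x : ℤ) * (γ.1 x : ℤ)

theorem sPerm_sPerm {n : ℕ} (i : Fin n) (x : SInt n) : sPerm i (sPerm i x) = x := by
  apply Subtype.ext
  have h1 := coe_sPerm i x
  have h2 := coe_sPerm i (sPerm i x)
  split_ifs at h1 h2 <;> omega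

/-- Since `s i` is an involution, twice the difference of the two heights is
`∑ x, (x - s i x) * (γ x - γ (s i x))`. Only `x = ±i, ±(i + 1)` contribute, and every one of them
contributes a positive amount. -/
theorem height_lt_height_mul_s {n : ℕ} {γ : SignedPerm n} {i : Fin n} (h : ¬ IsDescent γ i) :
    height γ < height (γ * s i) := by
  rw [isDescent_iff, gt_iff_lt, not_lt, ← Subtype.coe_le_coe] at h
  have hne : (γ.1 (lo i) : ℤ) ≠ γ.1 (SInt.pos i.succ) := fun e =>
    (lo_lt i).ne (γ.1.injective (Subtype.ext e))
  have hlt := lt_of_le_of_ne h hne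
  have hlo := Subtype.coe_lt_coe.2 (lo_lt i)
  have nn := fun x : SInt n => (congrArg Subtype.val (γ.2 x)).trans (SInt.coe_neg _)
  have key : ∀ x : SInt n, 0 ≤ ((x : ℤ) - sPerm i x) * ((γ.1 x : ℤ) - γ.1 (sPerm i x)) := by
    intro x
    by_cases h1 : x = SInt.pos i.succ
    · rw [h1, sPerm_hi]; exact mul_nonneg (by omega) (by omega)
    by_cases h2 : x = lo i
    · rw [h2, sPerm_lo]; exact mul_nonneg_of_nonpos_of_nonpos (by omega) (by omega)
    by_cases h3 : x = -SInt.pos i.succ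
    · rw [h3, sPerm_neg, sPerm_hi, nn, nn, SInt.coe_neg, SInt.coe_neg]
      exact mul_nonneg_of_nonpos_of_nonpos (by omega) (by omega)
    by_cases h4 : x = -lo i
    · rw [h4, sPerm_neg, sPerm_lo, nn, nn, SInt.coe_neg, SInt.coe_neg]
      exact mul_nonneg (by omega) (by omega)
    have cl := coe_lo i
    have ch := coe_hi i
    rw [Subtype.ext_iff] at h1 h2 h3 h4
    rw [SInt.coe_neg] at h3 h4
    rw [sPerm_fix i x (by omega), sub_self, zero_mul]
  -- The term of `x = i + 1` is positive.
  have hpos : 0 < ∑ x : SInt n, ((x : ℤ) - sPerm i x) * ((γ.1 x : ℤ) - γ.1 (sPerm i x)) := by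
    refine Finset.sum_pos' (fun x _ => key x) ⟨SInt.pos i.succ, Finset.mem_univ _, ?_⟩
    rw [sPerm_hi]; exact mul_pos (by omega) (by omega)
  have e1 : ∑ x : SInt n, (sPerm i x : ℤ) * (γ.1 (sPerm i x) : ℤ) =
      ∑ x : SInt n, (x : ℤ) * (γ.1 x : ℤ) :=
    Equiv.sum_comp (sPerm i) fun x : SInt n => (x : ℤ) * (γ.1 x : ℤ)
  have e2 : ∑ x : SInt n, (sPerm i x : ℤ) * (γ.1 x : ℤ) =
      ∑ x : SInt n, (x : ℤ) * (γ.1 (sPerm i x) : ℤ) := by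
    rw [← Equiv.sum_comp (sPerm i)]
    exact Finset.sum_congr rfl fun x _ => by rw [sPerm_sPerm]
  simp only [sub_mul, mul_sub, Finset.sum_sub_distrib, e1, e2] at hpos
  unfold height
  simp only [mul_s_apply]
  linarith

theorem isTriangular_posetOp {n : ℕ} (P : BPoset n) (i : Fin n) :
    IsTriangular (fun γ : sigmaB P => height γ.1)
      (fun γ => if i ∈ descents γ.1 then -1 else 0) (posetOp P i) := by
  intro γ
  rw [posetOp_single]
  by_cases h : IsDescent γ.1 i
  · simp [h, mem_descents]
  · by_cases h' : γ.1 * s i ∈ sigmaB P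
    · simp only [h, h', mem_descents, if_false, dif_pos, zero_smul, sub_zero]
      exact Finsupp.single_mem_supported ℂ 1 (height_lt_height_mul_s h)
    · simp [h, h', mem_descents]

instance {n : ℕ} (P : BPoset n) : Fintype (sigmaB P) := Fintype.ofFinite _

/-- The diagonal coefficient of `sep I` at `γ` is the product of those of its factors, which is `1`
if `I` is the descent set of `γ` and `0` otherwise. -/
theorem trOn_sep_posetModule {n : ℕ} (P : BPoset n) (I : Finset (Fin n)) :
    trOn (sep I) (posetModule P) = ∑ γ : sigmaB P, if I = descents γ.1 then 1 else 0 := by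
  have key : ∀ l : List (Fin n), IsTriangular (fun γ : sigmaB P => height γ.1)
      (fun γ => if ∀ i ∈ l, (i ∈ I ↔ i ∈ descents γ.1) then 1 else 0)
      (heckeRep (posetOps P)
        (l.map fun i => if i ∈ I then -opi i else 1 + opi i).prod).unop := by
    intro l
    induction l with
    | nil => simpa using IsTriangular.one
    | cons i l ih =>
      rw [List.map_cons, List.prod_cons, map_mul, MulOpposite.unop_mul]
      have hi : IsTriangular (fun γ : sigmaB P => height γ.1)
          (fun γ => if i ∈ I ↔ i ∈ descents γ.1 then 1 else 0)
          (heckeRep (posetOps P) (if i ∈ I then -opi i else 1 + opi i)).unop := by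
        by_cases h : i ∈ I
        · convert (isTriangular_posetOp P i).neg using 1
          · funext γ; by_cases h' : i ∈ descents γ.1 <;> simp [h, h']
          · simp [h]
        · convert IsTriangular.one.add (isTriangular_posetOp P i) using 1
          · funext γ; by_cases h' : i ∈ descents γ.1 <;> simp [h, h']
          · simp [h]
      convert ih.mul hi using 1
      funext γ
      by_cases h : i ∈ I ↔ i ∈ descents γ.1 <;> simp [h]
  have := (key (List.finRange n)).trace_eq
  simp only [List.mem_finRange, forall_true_left, ← Finset.ext_iff] at this
  exact this

/-- The traces of the elements `sep J` separate the points of the Grothendieck group. -/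
theorem G0.ext_trace {n : ℕ} {x y : G0 (HeckeB n)}
    (h : ∀ J, G0.lift (trOn (sep J)) (trOn_add (sep J)) x =
      G0.lift (trOn (sep J)) (trOn_add (sep J)) y) : x = y := by
  -- The trace of `sep J` is the `J`-th coordinate in the basis of simple classes.
  refine (simpleBasis n).ext_elem fun J => ?_
  have coord : ∀ z : G0 (HeckeB n), G0.lift (trOn (sep J)) (trOn_add (sep J)) z =
      ((simpleBasis n).repr z J : ℂ) := by
    intro z
    conv_lhs => rw [← (simpleBasis n).sum_repr z]
    simp only [map_sum, map_zsmul, simpleBasis_apply, G0.lift_mk, trOn_sep]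
    simp
  have := h J
  rw [coord, coord] at this
  exact_mod_cast this

/-- In the Grothendieck group, `[M^B_P]` is the sum of the classes of the simple modules indexed
by the descent sets of the elements of `Σ^B_R(P)`. -/
theorem G0.mk_posetModule {n : ℕ} (P : BPoset n) :
    G0.mk (posetModule P) = ∑ γ : sigmaB P, G0.mk (simpleModule (descents γ.1)) := by
  refine G0.ext_trace fun J => ?_
  simp only [map_sum, G0.lift_mk, trOn_sep, trOn_sep_posetModule]

/-! ### Sorting a type-`B` `P`-partition -/

/-- The permutation `γ` lists `[-n, n]` by increasing values of `f`, and elements with the same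
value in their natural order. -/
def Sorts {n : ℕ} (f : SInt n → ℤ) (γ : Equiv.Perm (SInt n)) : Prop :=
  ∀ a b, a < b → f (γ a) < f (γ b) ∨ f (γ a) = f (γ b) ∧ γ a < γ b

theorem Sorts.unique {n : ℕ} {f : SInt n → ℤ} {γ δ : Equiv.Perm (SInt n)} (hγ : Sorts f γ)
    (hδ : Sorts f δ) : γ = δ := by
  have hmono : StrictMono (γ⁻¹ * δ) := by
    intro a b hab
    by_contra hle
    rcases (not_lt.1 hle).lt_or_eq with hlt | heq
    · have h1 := hγ _ _ hlt
      have h2 := hδ _ _ hab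
      have apply_inv : ∀ x, γ (γ⁻¹ x) = x := fun x => by simp
      rw [Equiv.Perm.mul_apply, Equiv.Perm.mul_apply, apply_inv, apply_inv] at h1
      rcases h1 with h1 | h1 <;> rcases h2 with h2 | h2
      · omega
      · omega
      · omega
      · exact lt_asymm h1.2 h2.2
    · exact hab.ne ((γ⁻¹ * δ).injective heq).symm
  -- The identity is the only order automorphism of a finite linear order.
  have := Subsingleton.elim (hmono.orderIsoOfSurjective _ (γ⁻¹ * δ).surjective)
    (OrderIso.refl (SInt n))
  have h1 : γ⁻¹ * δ = 1 := Equiv.ext fun x => congrArg (fun e : SInt n ≃o SInt n => e x) this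
  exact inv_mul_eq_one.1 h1

/-- Every `f` is sorted by the order isomorphism from `[-n, n]` to the set of the pairs `(f x, x)`
in lexicographic order. -/
theorem exists_sorts {n : ℕ} (f : SInt n → ℤ) : ∃ γ, Sorts f γ := by
  let key : SInt n → ℤ ×ₗ SInt n := fun x => toLex (f x, x)
  have hkey : Function.Injective key := fun x y h => congrArg (fun p => (ofLex p).2) h
  let g : SInt n ≃ Set.range key := Equiv.ofInjective key hkey
  let e : SInt n ≃o Set.range key := (Fintype.orderIsoFinOfCardEq (SInt n) rfl).symm.trans
    (Fintype.orderIsoFinOfCardEq (Set.range key) (Fintype.card_congr g.symm))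
  refine ⟨e.toEquiv.trans g.symm, fun a b hab => ?_⟩
  have hk : ∀ x, key (g.symm (e x)) = e x := fun x =>
    congrArg Subtype.val (g.apply_symm_apply (e x))
  have := Subtype.coe_lt_coe.2 (e.strictMono hab)
  rw [← hk, ← hk, Prod.Lex.toLex_lt_toLex] at this
  exact this

/-- An odd function is sorted by a signed permutation: `γ` and `x ↦ -γ (-x)` both sort it. -/
theorem exists_signedPerm_sorts {n : ℕ} {f : SInt n → ℤ} (hf : ∀ x, f (-x) = -f x) :
    ∃ γ : SignedPerm n, Sorts f γ.1 := by
  obtain ⟨γ, hγ⟩ := exists_sorts f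
  let ν : Equiv.Perm (SInt n) := ⟨Neg.neg, Neg.neg, SInt.neg_neg, SInt.neg_neg⟩
  have lt_neg : ∀ x y : SInt n, x < y → -y < -x := by
    intro x y h
    rw [← Subtype.coe_lt_coe] at h ⊢
    rw [SInt.coe_neg, SInt.coe_neg]; omega
  have hν : Sorts f (ν * γ * ν) := by
    intro a b hab
    change f (-γ (-a)) < f (-γ (-b)) ∨ f (-γ (-a)) = f (-γ (-b)) ∧ -γ (-a) < -γ (-b)
    rw [hf, hf]
    rcases hγ _ _ (lt_neg _ _ hab) with h | h
    · left; omega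
    · exact Or.inr ⟨by omega, lt_neg _ _ h.2⟩
  refine ⟨⟨γ, fun x => ?_⟩, hγ⟩
  have := congrArg (fun e : Equiv.Perm (SInt n) => -e x) (hγ.unique hν)
  change -γ x = - -γ (-x) at this
  rw [this, SInt.neg_neg]

theorem mem_partitionsB_posetOfPerm {n : ℕ} {γ : SignedPerm n} {f : SInt n → ℤ} :
    f ∈ partitionsB (posetOfPerm γ) ↔ Sorts f γ.1 ∧ ∀ x, f (-x) = -f x := by
  have inv_apply : ∀ x, (γ⁻¹).1 (γ.1 x) = x := fun x => by simp
  have apply_inv : ∀ x, γ.1 ((γ⁻¹).1 x) = x := fun x => by simp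
  constructor
  · rintro ⟨h1, h2, h3⟩
    refine ⟨fun a b hab => ?_, h3⟩
    have hle : (posetOfPerm γ).le (γ.1 a) (γ.1 b) := by
      change (γ⁻¹).1 _ ≤ (γ⁻¹).1 _
      rw [inv_apply, inv_apply]; exact hab.le
    rcases lt_trichotomy (γ.1 a) (γ.1 b) with h | h | h
    · exact (h1 _ _ hle).lt_or_eq.imp_right fun e => ⟨e, h⟩
    · exact absurd (γ.1.injective h) hab.ne
    · exact Or.inl (h2 _ _ hle h)
  · rintro ⟨h1, h3⟩
    have key : ∀ i j, (posetOfPerm γ).le i j → i = j ∨ f i < f j ∨ f i = f j ∧ i < j := by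
      intro i j hij
      rcases (show (γ⁻¹).1 i ≤ (γ⁻¹).1 j from hij).lt_or_eq with h | h
      · have := h1 _ _ h
        rw [apply_inv, apply_inv] at this
        exact Or.inr this
      · exact Or.inl ((γ⁻¹).1.injective h)
    refine ⟨fun i j hij => ?_, fun i j hij hlt => ?_, h3⟩
    · rcases key i j hij with rfl | h | h
      · exact le_rfl
      · exact h.le
      · exact h.1.le
    · rcases key i j hij with rfl | h | h
      · exact absurd hlt (lt_irrefl _)
      · exact h
      · exact absurd hlt (lt_asymm h.2)

/-- The type-`B` `P`-partitions are the type-`B` `P(γ)`-partitions for `γ ∈ Σ^B_R(P)`. -/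
theorem partitionsB_eq_iUnion {n : ℕ} (P : BPoset n) :
    partitionsB P = ⋃ γ : sigmaB P, partitionsB (posetOfPerm γ.1) := by
  ext f
  rw [Set.mem_iUnion]
  constructor
  · rintro ⟨h1, h2, h3⟩
    obtain ⟨γ, hγ⟩ := exists_signedPerm_sorts h3
    refine ⟨⟨γ, mem_sigmaB.2 fun a b hab => ?_⟩, mem_partitionsB_posetOfPerm.2 ⟨hγ, h3⟩⟩
    by_contra hlt
    have h4 := h1 _ _ hab
    rcases hγ _ _ (not_le.1 hlt) with h | h
    · omega
    · have := h2 _ _ hab h.2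
      omega
  · rintro ⟨⟨γ, E, hE, rfl⟩, h1, h2, h3⟩
    exact ⟨fun i j hij => h1 i j (hE.1 i j hij), fun i j hij => h2 i j (hE.1 i j hij), h3⟩

theorem pairwise_disjoint_partitionsB {n : ℕ} {γ δ : SignedPerm n} (h : γ ≠ δ) :
    Disjoint (partitionsB (posetOfPerm γ)) (partitionsB (posetOfPerm δ)) := by
  rw [Set.disjoint_left]
  intro f hγ hδ
  exact h (Subtype.ext ((mem_partitionsB_posetOfPerm.1 hγ).1.unique
    (mem_partitionsB_posetOfPerm.1 hδ).1))

theorem KB_eq_sum {n : ℕ} (P : BPoset n) :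
    KB P = ∑ γ : sigmaB P, KB (posetOfPerm γ.1) := by
  ext m
  rw [map_sum]
  -- Compare the coefficients of the monomial `m`: both sides count finite sets.
  change ((Set.ncard _ : ℕ) : ℤ) = ∑ γ : sigmaB P, ((Set.ncard _ : ℕ) : ℤ)
  rw [← Nat.cast_sum, Nat.cast_inj, ← finsum_eq_sum_of_fintype, ← Set.ncard_iUnion_of_finite]
  · congr 1
    ext f
    simp only [partitionsB_eq_iUnion P, Set.mem_iUnion, Set.mem_ofPred_eq, exists_and_right]
  · exact fun γ => KB_finite _ m
  · intro γ δ h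
    exact (pairwise_disjoint_partitionsB fun e => h (Subtype.ext e)).mono
      (fun _ hf => hf.1) (fun _ hf => hf.1)

/-! ### The enumerator of a type-`B` linear order -/

theorem SInt.pos_zero_lt {n : ℕ} {j : Fin (n + 1)} (hj : j ≠ 0) :
    (SInt.pos 0 : SInt n) < SInt.pos j := by
  have := Fin.val_ne_zero_iff.2 hj
  rw [← Subtype.coe_lt_coe, SInt.coe_pos, SInt.coe_pos, Fin.val_zero]
  omega

theorem SInt.neg_pos_zero {n : ℕ} : -(SInt.pos 0 : SInt n) = SInt.pos 0 :=
  Subtype.ext (by simp)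

theorem signedPerm_apply_zero {n : ℕ} (γ : SignedPerm n) : γ.1 (SInt.pos 0) = SInt.pos 0 := by
  have := congrArg Subtype.val (γ.2 (SInt.pos 0))
  rw [SInt.neg_pos_zero, SInt.coe_neg] at this
  apply Subtype.ext
  simp only [SInt.coe_pos, Fin.val_zero]
  omega

theorem SInt.eq_pos_or_neg {n : ℕ} (x : SInt n) : ∃ j, x = SInt.pos j ∨ x = -SInt.pos j := by
  have h1 := x.2.1
  have h2 := x.2.2
  refine ⟨⟨(x : ℤ).natAbs, by omega⟩, ?_⟩
  rcases le_total 0 (x : ℤ) with h | h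
  · left; exact Subtype.ext (by change (x : ℤ) = ((x : ℤ).natAbs : ℤ); omega)
  · right; exact Subtype.ext (by change (x : ℤ) = -((x : ℤ).natAbs : ℤ); omega)

/-- The odd function on `[-n, n]` with the values `a j` at `j > 0`. -/
def oddExt {n : ℕ} (a : Fin (n + 1) → ℕ) (x : SInt n) : ℤ :=
  Int.sign x * a ⟨(x : ℤ).natAbs, by have := x.2.1; have := x.2.2; omega⟩

theorem oddExt_neg {n : ℕ} (a : Fin (n + 1) → ℕ) (x : SInt n) : oddExt a (-x) = -oddExt a x := by
  simp [oddExt]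

theorem oddExt_pos {n : ℕ} {a : Fin (n + 1) → ℕ} (ha : a 0 = 0) (j : Fin (n + 1)) :
    oddExt a (SInt.pos j) = a j := by
  by_cases h : j = 0
  · subst h; simp [oddExt, ha]
  · have : Int.sign ((j : ℕ) : ℤ) = 1 := Int.sign_eq_one_of_pos (by
      have := Fin.val_ne_zero_iff.2 h; omega)
    simp [oddExt, this]

/-- For odd `f`, being sorted by a signed permutation only has to be checked on the consecutive
pairs `j, j + 1` with `0 ≤ j`. -/
theorem sorts_of_consecutive {n : ℕ} {f : SInt n → ℤ} {γ : SignedPerm n}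
    (hf : ∀ x, f (-x) = -f x)
    (h : ∀ j : Fin n, f (γ.1 (SInt.pos j.castSucc)) < f (γ.1 (SInt.pos j.succ)) ∨
      f (γ.1 (SInt.pos j.castSucc)) = f (γ.1 (SInt.pos j.succ)) ∧
        γ.1 (SInt.pos j.castSucc) < γ.1 (SInt.pos j.succ)) : Sorts f γ.1 := by
  have step : ∀ x y : SInt n, (y : ℤ) = x + 1 →
      f (γ.1 x) < f (γ.1 y) ∨ f (γ.1 x) = f (γ.1 y) ∧ γ.1 x < γ.1 y := by
    intro x y hxy
    have hx1 := x.2.1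
    have hx2 := x.2.2
    have hy2 := y.2.2
    rcases le_or_gt 0 (x : ℤ) with h0 | h0
    · obtain ⟨j, hj⟩ : ∃ j : Fin n, (j : ℤ) = x :=
        ⟨⟨(x : ℤ).natAbs, by omega⟩, by simp; omega⟩
      rw [show x = SInt.pos j.castSucc from Subtype.ext (by simp [hj]),
        show y = SInt.pos j.succ from Subtype.ext (by simp [hj, hxy])]
      exact h j
    · obtain ⟨j, hj⟩ : ∃ j : Fin n, (j : ℤ) = -(y : ℤ) :=
        ⟨⟨(y : ℤ).natAbs, by omega⟩, by simp; omega⟩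
      rw [show x = -SInt.pos j.succ from Subtype.ext (by simp [hj, hxy]),
        show y = -SInt.pos j.castSucc from Subtype.ext (by simp [hj]), γ.2, γ.2, hf, hf,
        ← Subtype.coe_lt_coe, SInt.coe_neg, SInt.coe_neg]
      have := h j
      rw [← Subtype.coe_lt_coe] at this
      omega
  -- Extend the comparison from neighbours to all pairs, by induction on `b - a - 1`.
  have main : ∀ d : ℕ, ∀ a b : SInt n, (b : ℤ) = a + (d + 1 : ℕ) →
      f (γ.1 a) < f (γ.1 b) ∨ f (γ.1 a) = f (γ.1 b) ∧ γ.1 a < γ.1 b := by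
    intro d
    induction d with
    | zero => intro a b hab; exact step a b (by simpa using hab)
    | succ d ih =>
      intro a b hab
      have ha := a.2.1
      have hb := b.2.2
      let c : SInt n := ⟨(b : ℤ) - 1, by constructor <;> omega⟩
      have h1 := ih a c (by change (b : ℤ) - 1 = _; push_cast at hab ⊢; omega)
      have h2 := step c b (by change (b : ℤ) = (b : ℤ) - 1 + 1; omega)
      rw [← Subtype.coe_lt_coe] at h1 h2 ⊢
      omega
  intro a b hab
  rw [← Subtype.coe_lt_coe] at hab
  exact main ((b : ℤ) - a - 1).toNat a b (by omega)

/-- The absolute values of `γ 1, …, γ n` are a permutation of `1, …, n`. -/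
theorem sum_signedPerm {n : ℕ} {M : Type} [AddCommMonoid M] (γ : SignedPerm n) (φ : SInt n → M)
    (hφ : ∀ x, φ (-x) = φ x) :
    ∑ j : Fin n, φ (γ.1 (SInt.pos j.succ)) = ∑ j : Fin n, φ (SInt.pos j.succ) := by
  have hne : ∀ j : Fin n, (γ.1 (SInt.pos j.succ) : ℤ) ≠ 0 := by
    intro j h
    have : γ.1 (SInt.pos j.succ) = γ.1 (SInt.pos 0) := by
      rw [signedPerm_apply_zero γ]; exact Subtype.ext (by simpa using h)
    have := congrArg Subtype.val (γ.1.injective this)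
    simp at this
    omega
  have hb := fun j : Fin n => (γ.1 (SInt.pos j.succ)).2
  let σ : Fin n → Fin n := fun j => ⟨(γ.1 (SInt.pos j.succ) : ℤ).natAbs - 1, by
    have := hne j; have := (hb j).1; have := (hb j).2; omega⟩
  have hσ : ∀ j, γ.1 (SInt.pos j.succ) = SInt.pos (σ j).succ ∨
      γ.1 (SInt.pos j.succ) = -SInt.pos (σ j).succ := by
    intro j
    have := hne j
    rcases le_total 0 (γ.1 (SInt.pos j.succ) : ℤ) with h | h
    · left; apply Subtype.ext; simp [σ]; omega
    · right; apply Subtype.ext; simp [σ]; omega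
  have hinj : Function.Injective σ := by
    intro j k hjk
    have hj := hσ j
    have hk := hσ k
    rw [hjk] at hj
    have : γ.1 (SInt.pos j.succ) = γ.1 (SInt.pos k.succ) ∨
        γ.1 (SInt.pos j.succ) = γ.1 (-SInt.pos k.succ) := by
      rw [γ.2]
      rcases hj with hj | hj <;> rcases hk with hk | hk <;> simp [hj, hk, SInt.neg_neg]
    rcases this with h | h <;> have := congrArg Subtype.val (γ.1.injective h)
    · simp at this
      exact Fin.ext (by omega)
    · simp at this
      omega
  rw [← (Finite.injective_iff_bijective.1 hinj).sum_comp fun j => φ (SInt.pos j.succ)]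
  refine Finset.sum_congr rfl fun j _ => ?_
  rcases hσ j with h | h
  · rw [h]
  · rw [h, hφ]

/-- A type-`B` `P(γ)`-partition `f` corresponds to the sequence
`0 = f (γ 0) ≤ f (γ 1) ≤ ⋯ ≤ f (γ n)`, and the steps that have to be strict are the descents
of `γ`. -/
theorem KB_posetOfPerm {n : ℕ} (γ : SignedPerm n) :
    KB (posetOfPerm γ) = FB (descents γ) := by
  have inv_apply : ∀ x, (γ⁻¹).1 (γ.1 x) = x := fun x => by simp
  have apply_inv : ∀ x, γ.1 ((γ⁻¹).1 x) = x := fun x => by simp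
  have wt : ∀ f : SInt n → ℤ, (∀ x, f (-x) = -f x) →
      ∑ j : Fin n, Finsupp.single (f (γ.1 (SInt.pos j.succ))).natAbs 1 =
        ∑ j : Fin n, Finsupp.single (f (SInt.pos j.succ)).natAbs (1 : ℕ) := fun f hf =>
    sum_signedPerm γ (fun x => Finsupp.single (f x).natAbs (1 : ℕ)) fun x => by
      rw [hf, Int.natAbs_neg]
  ext m
  change ((Set.ncard _ : ℕ) : ℤ) = ((Set.ncard _ : ℕ) : ℤ)
  rw [Nat.cast_inj]
  -- The three goals: the map is well defined, injective and surjective.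
  refine Set.BijOn.ncard_eq (f := fun f j => (f (γ.1 (SInt.pos j))).natAbs) ⟨?_, ?_, ?_⟩
  · rintro f ⟨hf, hm⟩
    rw [mem_partitionsB_posetOfPerm] at hf
    obtain ⟨hs, hodd⟩ := hf
    have h0 : f (γ.1 (SInt.pos 0)) = 0 := by
      have := hodd (γ.1 (SInt.pos 0))
      rw [← γ.2, SInt.neg_pos_zero] at this
      omega
    have hnn : ∀ j, 0 ≤ f (γ.1 (SInt.pos j)) := by
      intro j
      by_cases hj : j = 0
      · rw [hj, h0]
      · have := hs (SInt.pos 0) (SInt.pos j) (SInt.pos_zero_lt hj)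
        omega
    have hstep := fun j : Fin n => hs (SInt.pos j.castSucc) (SInt.pos j.succ) (by
      rw [← Subtype.coe_lt_coe]; simp)
    refine ⟨⟨by simp [h0], fun j => ?_, fun j hj => ?_⟩, ?_⟩
    · have := hstep j
      have := hnn j.castSucc
      have := hnn j.succ
      change (f _).natAbs ≤ (f _).natAbs
      omega
    · rw [mem_descents] at hj
      have h1 := (hstep j).resolve_right fun h => lt_asymm h.2 hj
      have := hnn j.castSucc
      have := hnn j.succ
      change (f _).natAbs < (f _).natAbs
      omega
    · rw [← hm]; exact wt f hodd
  · rintro f ⟨hf, -⟩ g ⟨hg, -⟩ hfg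
    rw [mem_partitionsB_posetOfPerm] at hf hg
    have key : ∀ j, f (γ.1 (SInt.pos j)) = g (γ.1 (SInt.pos j)) := by
      intro j
      have h1 := congrFun hfg j
      have hf0 := hf.2 (γ.1 (SInt.pos 0))
      have hg0 := hg.2 (γ.1 (SInt.pos 0))
      rw [← γ.2, SInt.neg_pos_zero] at hf0 hg0
      by_cases hj : j = 0
      · rw [hj]; omega
      · have hlt : (SInt.pos 0 : SInt n) < SInt.pos j :=
          SInt.pos_zero_lt hj
        have := hf.1 _ _ hlt
        have := hg.1 _ _ hlt
        simp only at h1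
        omega
    funext x
    rw [← apply_inv x]
    obtain ⟨j, h | h⟩ := SInt.eq_pos_or_neg ((γ⁻¹).1 x)
    · rw [h, key]
    · rw [h, γ.2, hf.2, hg.2, key]
  · rintro a ⟨⟨h0, hle, hlt⟩, hm⟩
    -- The preimage of `a` is its odd extension, transported by `γ`.
    let f : SInt n → ℤ := fun x => oddExt a ((γ⁻¹).1 x)
    have hodd : ∀ x, f (-x) = -f x := fun x => by
      simp only [f]; rw [(γ⁻¹).2, oddExt_neg]
    have hval : ∀ j, f (γ.1 (SInt.pos j)) = a j := fun j => by
      simp only [f]; rw [inv_apply, oddExt_pos h0]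
    have himg : (fun j => (f (γ.1 (SInt.pos j))).natAbs) = a := by
      funext j; rw [hval, Int.natAbs_natCast]
    refine ⟨f, ⟨mem_partitionsB_posetOfPerm.2 ⟨sorts_of_consecutive hodd fun j => ?_, hodd⟩, ?_⟩,
      himg⟩
    · rw [hval, hval]
      have h1 := hle j
      by_cases hj : IsDescent γ j
      · have := hlt j (mem_descents.2 hj)
        left; omega
      · have hne : SInt.pos j.castSucc ≠ (SInt.pos j.succ : SInt n) := fun e => by
          have := congrArg Subtype.val e
          simp at this
        have h2 := lt_of_le_of_ne (not_lt.1 hj) fun e => hne (γ.1.injective e)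
        rcases h1.lt_or_eq with h | h
        · left; omega
        · exact Or.inr ⟨by omega, h2⟩
    · rw [← wt f hodd, ← hm]
      exact Finset.sum_congr rfl fun j _ => by rw [hval, Int.natAbs_natCast]

end TypeB

end

open TypeB
theorem mainTheorem3 (n : ℕ) (P : BPoset n) :
    (∀ (γ : sigmaB P) (i : Fin n),
      (IsDescent γ.1 i →
        MulOpposite.op (opi i) • posetBasis P γ = -posetBasis P γ) ∧
      (¬ IsDescent γ.1 i → γ.1 * s i ∉ sigmaB P →
        MulOpposite.op (opi i) • posetBasis P γ = 0) ∧
      (¬ IsDescent γ.1 i → ∀ h : γ.1 * s i ∈ sigmaB P,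
        MulOpposite.op (opi i) • posetBasis P γ = posetBasis P ⟨γ.1 * s i, h⟩)) ∧
    chB n (G0.mk (posetModule P)) = KB P := by
  have basis : ∀ γ : sigmaB P,
      posetBasis P γ = (Finsupp.single γ 1 : sigmaB P →₀ ℂ) := fun γ =>
    congrFun Finsupp.coe_basisSingleOne γ
  have act : ∀ (γ : sigmaB P) (i : Fin n), MulOpposite.op (opi i) • posetBasis P γ =
      posetOp P i (Finsupp.single γ 1) := fun γ i => by
    rw [basis]; exact heckeModule_opi _ (posetOps P) i _
  refine ⟨fun γ i => ⟨fun h => ?_, fun h h' => ?_, fun h h' => ?_⟩, ?_⟩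
  · rw [act, posetOp_single, if_pos h, basis]; rfl
  · rw [act, posetOp_single, if_neg h, dif_neg h']; rfl
  · rw [act, posetOp_single, if_neg h, dif_pos h', basis]
  · rw [G0.mk_posetModule, map_sum, KB_eq_sum]
    exact Finset.sum_congr rfl fun γ _ => by rw [chB_simple, KB_posetOfPerm]
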